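/- Let $m\ge 3$ and $n\ge 3$ be integers, let $M$ be a compact $n$-dimensional manifold with boundary, of class $C^{m+1}$, and let $\bar g$ be a Riemannian metric of class $C^m$ on $M$. Let $\nu$ be the outward unit normal to $\partial M$ with respect to $\bar g$. For a $C^m$ metric $g$ on $M$ let $\mathbb{I}_g$, with components $h_{ij}$ in local coordinates of $\partial M$, be the second fundamental form of $\partial M$ with respect to $g$, and put $\|\mathbb{I}_g\|^2=g^{ik}g^{j\ell}h_{ij}h_{k\ell}$ and $H_g=g^{ij}h_{ij}$; the boundary is minimal for $g$ if $H_g=0$ on $\partial M$. Assume that $\bar g$ has minimal boundary and that $\mathbb{I}_{\bar g}(p)\neq 0$ for every $p\in\partial M$. Let $[\bar g]=\{e^{2u}\bar g : u\in C^m(M)\}$. Then the following hold. (a) $\{g\in[\bar g] : (M,g)\text{ has minimal boundary}\}=\{e^{2u}\bar g : u\in C^m(M),\ \partial u/\partial\nu=0\text{ on }\partial M\}$, and for every $u\in C^m(M)$ with $\partial u/\partial\nu=0$ on $\partial M$ one has $\|\mathbb{I}_{e^{2u}\bar g}\|^2=e^{-2u}\|\mathbb{I}_{\bar g}\|^2$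 on $\partial M$. (b) The set $$\mathcal B=\{g\in[\bar g] : (M,g)\text{ has minimal boundary and all critical points of }\|\mathbb{I}_g\|^2\text{ on }\partial M\text{ are non-degenerate}\}$$ is an open dense subset of $\{g\in[\bar g] : (M,g)\text{ has minimal boundary}\}$ in the topology induced by the $C^m$ topology on the space of $C^m$ metrics on $M$. -/

import Mathlib

open Set Topology Manifold ContDiff Bundle
open scoped UniformConvergence

noncomputable section

namespace BoundaryMorse

/-- Riemannian metrics of class `C^m` on a manifold with boundary `M` of dimension `d + 1`. -/
abbrev RiemMetric (m d : ℕ) (M : Type*) [TopologicalSpace M]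
    [ChartedSpace (EuclideanHalfSpace (d + 1)) M] [IsManifold (𝓡∂ (d + 1)) 1 M] :=
  ContMDiffRiemannianMetric (𝓡∂ (d + 1)) (m : WithTop ℕ∞) (EuclideanSpace ℝ (Fin (d + 1)))
    (fun x : M => TangentSpace (𝓡∂ (d + 1)) x)

/-- The coordinate basis vector `∂ᵢ` of `ℝᵈ⁺¹`. The half space is `{x₀ ≥ 0}`, so that `∂₀` points
into the manifold and the `∂ᵢ` with `i ≠ 0` are tangent to the boundary. -/
def coordVec {d : ℕ} (i : Fin (d + 1)) : EuclideanSpace ℝ (Fin (d + 1)) :=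
  EuclideanSpace.single i 1

variable {m d : ℕ} {M : Type*} [TopologicalSpace M]
  [ChartedSpace (EuclideanHalfSpace (d + 1)) M] [IsManifold (𝓡∂ (d + 1)) 1 M]

/-- The component `g_ij` of `g` in the preferred chart around `p`, as a function of the
coordinates `y`. -/
def metricComp (g : RiemMetric m d M) (p : M) (i j : Fin (d + 1))
    (y : EuclideanSpace ℝ (Fin (d + 1))) : ℝ :=
  let x := (extChartAt (𝓡∂ (d + 1)) p).symm y
  let e := trivializationAt (EuclideanSpace ℝ (Fin (d + 1)))
    (TangentSpace (𝓡∂ (d + 1)) : M → Type _) p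
  g.inner x (e.symm x (coordVec i)) (e.symm x (coordVec j))

/-- The `C^m` topology on the metrics of class `C^m`: uniform convergence, on the compact subsets
of the domains of the charts, of all the partial derivatives of order at most `m` of all the
components of the metric. -/
instance : TopologicalSpace (RiemMetric m d M) :=
  ⨅ (p : M) (i : Fin (d + 1)) (j : Fin (d + 1)) (k : Fin (m + 1)),
    TopologicalSpace.induced
      (fun g => UniformOnFun.ofFun {K | IsCompact K ∧ K ⊆ (extChartAt (𝓡∂ (d + 1)) p).target}
        (iteratedFDerivWithin ℝ (k : ℕ) (metricComp g p i j)
          (extChartAt (𝓡∂ (d + 1)) p).target))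
      inferInstance

/-- The matrix `(g_ij)` at the point `p`, in the preferred chart at `p`. -/
def gram (g : RiemMetric m d M) (p : M) : Matrix (Fin (d + 1)) (Fin (d + 1)) ℝ :=
  fun i j => metricComp g p i j (extChartAt (𝓡∂ (d + 1)) p p)

/-- The matrix at `p ∈ ∂M` of the metric induced by `g` on the boundary. -/
def boundaryGram (g : RiemMetric m d M) (p : M) : Matrix (Fin d) (Fin d) ℝ :=
  fun i j => gram g p i.succ j.succ

/-- The partial derivative `∂ₖ g_ij` at `p`, in the preferred chart at `p`. -/
def metricDeriv (g : RiemMetric m d M) (p : M) (k i j : Fin (d + 1)) : ℝ :=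
  fderivWithin ℝ (metricComp g p i j) (range (𝓡∂ (d + 1))) (extChartAt (𝓡∂ (d + 1)) p p)
    (coordVec k)

/-- The Christoffel symbol of the first kind `g(∇_{∂ᵢ} ∂ⱼ, ∂ₖ)` of the Levi-Civita connection
at `p`. -/
def christoffel (g : RiemMetric m d M) (p : M) (i j k : Fin (d + 1)) : ℝ :=
  (metricDeriv g p i j k + metricDeriv g p j i k - metricDeriv g p k i j) / 2

/-- The components `ν^k` of the outward unit normal to the boundary at `p ∈ ∂M`: it is
`- grad x₀ / |grad x₀|`, so that `ν^k = - g^{k0} / √g^{00}`. -/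
def normalComp (g : RiemMetric m d M) (p : M) (k : Fin (d + 1)) : ℝ :=
  -((gram g p)⁻¹ k 0) / √((gram g p)⁻¹ 0 0)

/-- The outward unit normal `ν` to the boundary at `p ∈ ∂M`. -/
def outwardNormal (g : RiemMetric m d M) (p : M) : TangentSpace (𝓡∂ (d + 1)) p :=
  (WithLp.toLp 2 (normalComp g p) : EuclideanSpace ℝ (Fin (d + 1)))

/-- The components `h_ij = - g(∇_{∂ᵢ} ∂ⱼ, ν) = g(∇_{∂ᵢ} ν, ∂ⱼ)` at `p ∈ ∂M` of the second
fundamental form of the boundary, in the boundary coordinates `x₁, …, x_d`. -/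
def secondFundamentalForm (g : RiemMetric m d M) (p : M) : Matrix (Fin d) (Fin d) ℝ :=
  fun i j => -∑ k : Fin (d + 1), christoffel g p i.succ j.succ k * normalComp g p k

/-- The boundary mean curvature `H = g^{ij} h_ij` at `p ∈ ∂M`. -/
def meanCurvature (g : RiemMetric m d M) (p : M) : ℝ :=
  ∑ i, ∑ j, (boundaryGram g p)⁻¹ i j * secondFundamentalForm g p i j

/-- The squared norm `g^{ik} g^{jl} h_ij h_kl` of the second fundamental form at `p ∈ ∂M`. -/
def normSqSecondFundamentalForm (g : RiemMetric m d M) (p : M) : ℝ :=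
  ∑ i, ∑ j, ∑ k, ∑ l, (boundaryGram g p)⁻¹ i k * (boundaryGram g p)⁻¹ j l *
    secondFundamentalForm g p i j * secondFundamentalForm g p k l

/-- The boundary of `(M, g)` is minimal. -/
def HasMinimalBoundary (g : RiemMetric m d M) : Prop :=
  ∀ p ∈ (𝓡∂ (d + 1)).boundary M, meanCurvature g p = 0

/-- The outward normal derivative `∂u/∂ν` at `p ∈ ∂M`. -/
def normalDeriv (g : RiemMetric m d M) (u : M → ℝ) (p : M) : ℝ :=
  (mfderiv (𝓡∂ (d + 1)) 𝓘(ℝ, ℝ) u p (outwardNormal g p) : ℝ)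

/-- The restriction of `f` to the boundary, near `p ∈ ∂M`, in the boundary coordinates
`x₁, …, x_d` given by the preferred chart at `p`. -/
def boundaryRep {d : ℕ} {M : Type*} [TopologicalSpace M]
    [ChartedSpace (EuclideanHalfSpace (d + 1)) M] (f : M → ℝ) (p : M) (y : EuclideanSpace ℝ (Fin d)) : ℝ :=
  f ((extChartAt (𝓡∂ (d + 1)) p).symm (WithLp.toLp 2 (Fin.cons 0 y.ofLp)))

/-- The coordinates of `p ∈ ∂M` in the boundary coordinates `x₁, …, x_d`. -/
def boundaryCoord (d : ℕ) {M : Type*} [TopologicalSpace M]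
    [ChartedSpace (EuclideanHalfSpace (d + 1)) M] (p : M) : EuclideanSpace ℝ (Fin d) :=
  WithLp.toLp 2 (fun i => extChartAt (𝓡∂ (d + 1)) p p i.succ)

/-- `f` has only non-degenerate critical points on the boundary: wherever on `∂M` the tangential
differential of `f` vanishes, the Hessian of the restriction of `f` to `∂M` is a non-degenerate
bilinear form. Only the values of `f` on `∂M` matter. -/
def IsMorseOnBoundary (d : ℕ) {M : Type*} [TopologicalSpace M]
    [ChartedSpace (EuclideanHalfSpace (d + 1)) M] (f : M → ℝ) : Prop :=
  ∀ p ∈ (𝓡∂ (d + 1)).boundary M, fderiv ℝ (boundaryRep f p) (boundaryCoord d p) = 0 →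
    ∀ v : EuclideanSpace ℝ (Fin d),
      (∀ w, fderiv ℝ (fderiv ℝ (boundaryRep f p)) (boundaryCoord d p) v w = 0) → v = 0

set_option synthInstance.maxHeartbeats 200000 in
/-- The conformal metric `e^{2u} g`. -/
def conformalMetric (g : RiemMetric m d M) (u : C^m⟮𝓡∂ (d + 1), M; 𝓘(ℝ, ℝ), ℝ⟯) : RiemMetric m d M where
  inner x := Real.exp (2 * u x) • g.inner x
  symm x v w := by simp [g.symm x v w]
  pos x v hv := by
    have := g.pos x v hv
    simp only [smul_apply, smul_eq_mul]
    positivity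
  isVonNBounded x := by
    have h := (g.isVonNBounded x).image
      ((Real.exp (-u x)) • ContinuousLinearMap.id ℝ (TangentSpace (𝓡∂ (d + 1)) x))
    refine h.subset ?_
    intro v hv
    refine ⟨Real.exp (u x) • v, ?_, ?_⟩
    · simp only [mem_ofPred_eq, smul_apply, smul_eq_mul, map_smul] at hv ⊢
      rwa [← mul_assoc, ← Real.exp_add, ← two_mul]
    · simp [smul_smul, ← Real.exp_add]
  contMDiff := by
    have hu : ContMDiff (𝓡∂ (d + 1)) 𝓘(ℝ, ℝ) m (fun x => Real.exp (2 * u x)) := by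
      have h1 : ContMDiff 𝓘(ℝ, ℝ) 𝓘(ℝ, ℝ) m (fun t : ℝ => Real.exp (2 * t)) := by
        rw [contMDiff_iff_contDiff]
        fun_prop
      exact h1.comp u.contMDiff
    exact hu.smul_section g.contMDiff

/-- The conformal class `[g]`: the metrics `e^{2u} g` with `u` of class `C^m`. -/
def conformalClass (g : RiemMetric m d M) : Set (RiemMetric m d M) :=
  range (conformalMetric g)

/-- The metrics in the conformal class `[g]` that have minimal boundary. -/
def minimalConformalClass (g : RiemMetric m d M) : Set (RiemMetric m d M) :=
  {g' | g' ∈ conformalClass g ∧ HasMinimalBoundary g'}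

end BoundaryMorse

end

open BoundaryMorse

noncomputable section

namespace BoundaryMorse

/-! ### Linear algebra -/

/-! Conformal part. Since e^{2u}g has unit normal e^{-u}ν and its Christoffel symbols change by
explicit first-order terms in u, the second fundamental form becomes e^u(h + (∂u/∂ν) g) on ∂M
(`secondFormAt_conformalMetric`). Tracing gives the mean curvature e^{-u}(H + d ∂u/∂ν), so, starting
from H = 0, minimality is preserved exactly when ∂u/∂ν = 0. In that case h scales by e^u and the
metric by e^{2u}, hence ‖𝕀‖² scales by e^{-2u}.

Localisation. All pointwise quantities are defined in the preferred chart at the point itself,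
whereas analysis needs a fixed chart. `normSqAt_transition` shows that ‖𝕀‖² does not depend on the
chart, and `nondegenerateAt_boundaryRep_of_mem` does the same for non-degeneracy of critical points.
By compactness the Morse condition becomes finitely many conditions, each on a compact ball of
boundary coordinates (`isMorseOnBoundary_iff`); it is enough that each of them is open and dense.

Openness (`isOpen_nondegenerate`). On the minimal conformal class the product of ‖𝕀‖² and the
component g₀₀ is one fixed positive function. So ‖𝕀‖² is that function divided by g₀₀, and
degeneracy of a critical point is the vanishing of a continuous function of the 2-jet of g₀₀, the
point and a unit vector. Non-vanishing on a compact set is an open condition.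

Density (`dense_nondegenerate`). Add to u a combination ∑ tⱼwⱼ of functions with zero normal
derivative that restrict to the boundary coordinates near the ball. This multiplies ‖𝕀‖² by
exp(-2⟨t, y⟩). With L = ½ log ‖𝕀‖², a degenerate critical point can occur only if t is a critical
value of ∇L, and such t form a null set by the equidimensional case of Sard's theorem. The case
needs only L of class C²; as ‖𝕀‖² has one derivative less than the metric, this is where m ≥ 3
enters. -/

lemma inv_smul_matrix {n : ℕ} (A : Matrix (Fin n) (Fin n) ℝ) {a : ℝ} (ha : a ≠ 0) :
    (a • A)⁻¹ = a⁻¹ • A⁻¹ := by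
  by_cases hA : IsUnit A.det
  · exact Matrix.inv_smul' _ (Units.mk0 a ha) hA
  -- For singular `A` both inverses take the default value 0.
  · rw [Matrix.nonsing_inv_apply_not_isUnit _ hA, Matrix.nonsing_inv_apply_not_isUnit, smul_zero]
    rw [Matrix.det_smul]
    intro h
    exact hA (isUnit_of_mul_isUnit_right h)

/-- The full contraction `G^{ik} G^{jl} h_ij h_kl` of a bilinear form with itself. -/
def contraction {d : ℕ} (G h : Matrix (Fin d) (Fin d) ℝ) : ℝ :=
  ∑ i, ∑ j, ∑ k, ∑ l, G⁻¹ i k * G⁻¹ j l * h i j * h k l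

/-- In trace form, factors coming from a change of basis cancel by cyclicity, and positivity becomes
that of a Frobenius norm. -/
lemma contraction_eq_trace {d : ℕ} (G h : Matrix (Fin d) (Fin d) ℝ) :
    contraction G h = (G⁻¹.transpose * h * G⁻¹ * h.transpose).trace := by
  simp only [contraction, Matrix.trace, Matrix.diag, Matrix.mul_apply, Matrix.transpose_apply,
    Finset.sum_mul]
  rw [Finset.sum_comm]
  have h1 : ∀ j : Fin d, (∑ i, ∑ k, ∑ l, G⁻¹ i k * G⁻¹ j l * h i j * h k l) =
      ∑ k, ∑ l, ∑ i, G⁻¹ i k * G⁻¹ j l * h i j * h k l := fun j => by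
    rw [Finset.sum_comm]
    exact Finset.sum_congr rfl fun k _ => Finset.sum_comm
  rw [Finset.sum_congr rfl fun j _ => h1 j, Finset.sum_comm]
  refine Finset.sum_congr rfl fun k _ => ?_
  rw [Finset.sum_comm]
  exact Finset.sum_congr rfl fun l _ => Finset.sum_congr rfl fun j _ =>
    Finset.sum_congr rfl fun i _ => by ring

/-- Invariance under a change of boundary coordinates with Jacobian `K`. The factor `c` stands for
the sign of the unit normal; the contraction is quadratic in `h`, so only `c ^ 2 = 1` matters. -/
lemma contraction_congr {d : ℕ} {G h K : Matrix (Fin d) (Fin d) ℝ} {c : ℝ} (hc : c ^ 2 = 1)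
    (hK : K.det ≠ 0) :
    contraction (K.transpose * G * K) (c • (K.transpose * h * K)) = contraction G h := by
  have hu : IsUnit K.det := hK.isUnit
  have hu' : IsUnit K.transpose.det := by rwa [Matrix.det_transpose]
  rw [contraction_eq_trace, contraction_eq_trace]
  simp only [Matrix.mul_inv_rev, Matrix.transpose_mul, Matrix.transpose_smul,
    Matrix.transpose_transpose, Matrix.mul_smul, Matrix.smul_mul, Matrix.trace_smul, smul_smul,
    Matrix.transpose_nonsing_inv]
  rw [← sq, hc, one_smul]
  have : K⁻¹ * G.transpose⁻¹ * K.transpose⁻¹ * (K.transpose * h * K) *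
      (K⁻¹ * (G⁻¹ * K.transpose⁻¹)) * (K.transpose * (h.transpose * K)) =
      K⁻¹ * (G.transpose⁻¹ * h * G⁻¹ * h.transpose * K) := by
    calc _ = K⁻¹ * (G.transpose⁻¹ * (K.transpose⁻¹ * K.transpose) * h * (K * K⁻¹) *
          G⁻¹ * (K.transpose⁻¹ * K.transpose) * h.transpose * K) := by
          simp only [Matrix.mul_assoc]
      _ = _ := by
          rw [Matrix.nonsing_inv_mul _ hu', Matrix.mul_nonsing_inv _ hu]
          simp only [Matrix.mul_one, Matrix.mul_assoc]
  rw [this, Matrix.trace_mul_comm, Matrix.mul_assoc, Matrix.mul_nonsing_inv _ hu, Matrix.mul_one]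

lemma contraction_smul {d : ℕ} (G h : Matrix (Fin d) (Fin d) ℝ) {a b : ℝ} (ha : a ≠ 0) :
    contraction (a • G) (b • h) = (b / a) ^ 2 * contraction G h := by
  simp only [contraction, inv_smul_matrix _ ha, Matrix.smul_apply, smul_eq_mul, Finset.mul_sum]
  refine Finset.sum_congr rfl fun i _ => Finset.sum_congr rfl fun j _ =>
    Finset.sum_congr rfl fun k _ => Finset.sum_congr rfl fun l _ => ?_
  field_simp

open scoped Matrix MatrixOrder Matrix.Norms.L2Operator in
-- Writing G⁻¹ = BᴴB with `B` invertible, the contraction is the squared Frobenius norm of B h Bᴴ.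
lemma contraction_pos {d : ℕ} {G h : Matrix (Fin d) (Fin d) ℝ} (hG : G.PosDef) (hh : h ≠ 0) :
    0 < contraction G h := by
  obtain ⟨B, e⟩ : ∃ B : Matrix (Fin d) (Fin d) ℝ, G⁻¹ = Bᴴ * B :=
    CStarAlgebra.nonneg_iff_eq_star_mul_self.mp hG.inv.posSemidef.nonneg
  have hB : IsUnit B := by
    have h1 := hG.inv.det_pos
    rw [e, Matrix.det_mul] at h1
    exact (Matrix.isUnit_iff_isUnit_det _).2 (right_ne_zero_of_mul h1.ne').isUnit
  have e2 : contraction G h = ((B * h * Bᴴ) * (B * h * Bᴴ)ᴴ).trace := by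
    rw [contraction_eq_trace, e]
    simp only [Matrix.conjTranspose_eq_transpose_of_trivial, Matrix.transpose_mul,
      Matrix.transpose_transpose]
    rw [Matrix.mul_assoc, Matrix.mul_assoc, Matrix.mul_assoc, Matrix.trace_mul_comm]
    simp only [Matrix.mul_assoc]
  rw [e2]
  refine lt_of_le_of_ne (Matrix.posSemidef_self_mul_conjTranspose _).trace_nonneg fun h0 => hh ?_
  have h1 := Matrix.trace_mul_conjTranspose_self_eq_zero_iff.1 h0.symm
  have hB' : IsUnit Bᴴ := by simpa using hB.star
  have h2 : B * h = 0 := by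
    obtain ⟨u, hu⟩ := hB'
    rw [← hu] at h1
    simpa using congrArg (· * (↑u⁻¹ : Matrix (Fin d) (Fin d) ℝ)) h1
  obtain ⟨u, rfl⟩ := hB
  simpa using congrArg ((↑u⁻¹ : Matrix (Fin d) (Fin d) ℝ) * ·) h2

/-! ### The Christoffel symbols of a field of bilinear forms -/

section Koszul

variable {E : Type*} [NormedAddCommGroup E] [NormedSpace ℝ E]

set_option synthInstance.maxHeartbeats 200000 in
/-- The Christoffel symbol of the first kind `g(∇_u v, w)` of a field of bilinear forms with
derivative `T`. -/
def koszul (T : E →L[ℝ] E →L[ℝ] E →L[ℝ] ℝ) (u v w : E) : ℝ :=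
  (T u v w + T v u w - T w u v) / 2

set_option synthInstance.maxHeartbeats 200000 in
-- Transformation law of Christoffel symbols of the first kind. The derivative of the pulled-back
-- form has two terms containing `D2`; since `D2` and `B` are symmetric, the Koszul combination
-- leaves only the single non-tensorial term.
lemma koszul_pullback {B Bq : E → E →L[ℝ] E →L[ℝ] ℝ} {τ : E → E} {D : E → E →L[ℝ] E} {s : Set E}
    {y : E} {T T' : E →L[ℝ] E →L[ℝ] E →L[ℝ] ℝ} {D2 : E →L[ℝ] E →L[ℝ] E}
    (hs : UniqueDiffWithinAt ℝ s y) (hy : y ∈ s)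
    (hT : HasFDerivWithinAt B T s (τ y)) (hT' : HasFDerivWithinAt Bq T' s y)
    (hτ : HasFDerivWithinAt τ (D y) s y) (hτs : MapsTo τ (s ∩ τ ⁻¹' s) s)
    (hτn : ∀ᶠ z in 𝓝[s] y, τ z ∈ s)
    (hD : HasFDerivWithinAt D D2 s y) (hD2 : ∀ u v, D2 u v = D2 v u)
    (hB : ∀ u v, B (τ y) u v = B (τ y) v u)
    (h : ∀ᶠ z in 𝓝[s] y, ∀ v w, Bq z v w = B (τ z) (D z v) (D z w)) (u v w : E) :
    koszul T' u v w = koszul T (D y u) (D y v) (D y w) + B (τ y) (D2 u v) (D y w) := by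
  have hBτ : HasFDerivWithinAt (fun z => B (τ z)) (T.comp (D y)) s y := by
    have h1 : HasFDerivWithinAt τ (D y) (s ∩ τ ⁻¹' s) y := hτ.mono inter_subset_left
    -- The chain rule holds on `s ∩ τ ⁻¹' s`, which by `hτn` is a neighbourhood of `y` within `s`.
    have h2 : HasFDerivWithinAt (B ∘ τ) (T.comp (D y)) (s ∩ τ ⁻¹' s) y :=
      HasFDerivWithinAt.comp (g := B) (g' := T) (t := s) y hT h1 hτs
    refine h2.mono_of_mem_nhdsWithin ?_
    filter_upwards [hτn, self_mem_nhdsWithin] with z hz hz' using ⟨hz', hz⟩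
  have key : ∀ a b c, T' a b c = T (D y a) (D y b) (D y c) + B (τ y) (D2 a b) (D y c) +
      B (τ y) (D y b) (D2 a c) := by
    intro a b c
    have hb := hD.clm_apply (hasFDerivWithinAt_const b y s)
    have hc := hD.clm_apply (hasFDerivWithinAt_const c y s)
    have h3 := (hBτ.clm_apply hb).clm_apply hc
    have h4 := (hT'.clm_apply (hasFDerivWithinAt_const b y s)).clm_apply
      (hasFDerivWithinAt_const c y s)
    have h5 := h3.congr_of_eventuallyEq (f₁ := fun z => Bq z b c)
      (h.mono fun z hz => hz b c) (h.self_of_nhdsWithin hy b c)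
    have h6 := DFunLike.congr_fun (hs.eq h4 h5) a
    simp at h6
    rw [h6]
    ring
  simp only [koszul, key]
  rw [hD2 v u, hD2 w u, hD2 w v, hB (D y u) (D2 v w), hB (D y v) (D2 u w)]
  ring

end Koszul

/-! ### The metric in a chart -/

section ChartMetric

variable {m d : ℕ} {M : Type*} [TopologicalSpace M]
  [ChartedSpace (EuclideanHalfSpace (d + 1)) M] [IsManifold (𝓡∂ (d + 1)) 1 M]

lemma mem_range_halfSpace {y : EuclideanSpace ℝ (Fin (d + 1))} :
    y ∈ range (𝓡∂ (d + 1)) ↔ 0 ≤ y 0 := by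
  rw [range_modelWithCornersEuclideanHalfSpace]; rfl

/-- Being an interior point does not depend on the chart, so the boundary can be read off from the
coordinate y₀ of any preferred chart, not only the one at `x`. -/
lemma mem_boundary_iff_of_mem_source {p x : M} (hx : x ∈ (extChartAt (𝓡∂ (d + 1)) p).source) :
    x ∈ (𝓡∂ (d + 1)).boundary M ↔ extChartAt (𝓡∂ (d + 1)) p x 0 = 0 := by
  have h1 := (𝓡∂ (d + 1)).isInteriorPoint_iff_of_mem_atlas (M := M) (n := 1) one_ne_zero
    (chart_mem_atlas (EuclideanHalfSpace (d + 1)) p) (by simpa using hx)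
  have h2 : extChartAt (𝓡∂ (d + 1)) p x ∈ interior (extChartAt (𝓡∂ (d + 1)) p).target ↔
      extChartAt (𝓡∂ (d + 1)) p x ∈ interior (range (𝓡∂ (d + 1))) := by
    refine ⟨fun h => interior_mono (extChartAt_target_subset_range p) h, fun h => ?_⟩
    exact (chartAt (EuclideanHalfSpace (d + 1)) p).mem_interior_extend_target
      ((chartAt _ p).map_source (by simpa using hx)) h
  have h3 : 0 ≤ extChartAt (𝓡∂ (d + 1)) p x 0 := mem_range_halfSpace.1 (mem_range_self _)
  have h4 : x ∈ (𝓡∂ (d + 1)).boundary M ↔ ¬ (𝓡∂ (d + 1)).IsInteriorPoint x :=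
    (𝓡∂ (d + 1)).isBoundaryPoint_iff_not_isInteriorPoint x
  rw [h4, h1]
  change ¬ extChartAt (𝓡∂ (d + 1)) p x ∈ interior (extChartAt (𝓡∂ (d + 1)) p).target ↔ _
  rw [h2, interior_range_modelWithCornersEuclideanHalfSpace, mem_ofPred_eq]
  exact ⟨fun h => le_antisymm (not_lt.1 h) h3, fun h => not_lt.2 h.le⟩

lemma mem_boundary_iff (x : M) :
    x ∈ (𝓡∂ (d + 1)).boundary M ↔ extChartAt (𝓡∂ (d + 1)) x x 0 = 0 :=
  mem_boundary_iff_of_mem_source (mem_extChartAt_source x)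

lemma contMDiffVectorBundle_tangentSpace
    [h : IsManifold (𝓡∂ (d + 1)) ((m + 1 : ℕ) : WithTop ℕ∞) M] :
    ContMDiffVectorBundle (m : WithTop ℕ∞) (EuclideanSpace ℝ (Fin (d + 1)))
      (TangentSpace (𝓡∂ (d + 1)) : M → Type _) (𝓡∂ (d + 1)) := by
  have : IsManifold (𝓡∂ (d + 1)) ((m : WithTop ℕ∞) + 1) M := by exact_mod_cast h
  exact TangentBundle.contMDiffVectorBundle

set_option synthInstance.maxHeartbeats 200000 in
-- The manifold has class C^{m+1}, so its tangent bundle and the coordinate frames have class C^m,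
-- like the metric.
lemma contDiffOn_metricComp [h : IsManifold (𝓡∂ (d + 1)) ((m + 1 : ℕ) : WithTop ℕ∞) M]
    (g : RiemMetric m d M) (p : M) (i j : Fin (d + 1)) :
    ContDiffOn ℝ m (metricComp g p i j) (extChartAt (𝓡∂ (d + 1)) p).target := by
  have := contMDiffVectorBundle_tangentSpace (m := m) (d := d) (M := M)
  have : IsManifold (𝓡∂ (d + 1)) (m : WithTop ℕ∞) M :=
    IsManifold.of_le (n := ((m + 1 : ℕ) : WithTop ℕ∞)) (by exact_mod_cast Nat.le_succ m)
  let e := trivializationAt (EuclideanSpace ℝ (Fin (d + 1)))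
    (TangentSpace (𝓡∂ (d + 1)) : M → Type _) p
  have hs : ∀ v : EuclideanSpace ℝ (Fin (d + 1)), ContMDiffOn (𝓡∂ (d + 1))
      ((𝓡∂ (d + 1)).prod 𝓘(ℝ, EuclideanSpace ℝ (Fin (d + 1)))) m
      (fun x => TotalSpace.mk' (EuclideanSpace ℝ (Fin (d + 1)))
        (E := (TangentSpace (𝓡∂ (d + 1)) : M → Type _)) x (e.symm x v)) e.baseSet := by
    intro v
    rw [e.contMDiffOn_section_baseSet_iff]
    refine (contMDiffOn_const (c := v)).congr fun y hy => ?_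
    simp [e.apply_mk_symm hy]
  have h1 : ContMDiffOn (𝓡∂ (d + 1)) 𝓘(ℝ, ℝ) m
      (fun x => g.inner x (e.symm x (coordVec i)) (e.symm x (coordVec j))) e.baseSet := by
    have h2 := ContMDiffOn.clm_bundle_apply₂ (F₁ := EuclideanSpace ℝ (Fin (d + 1)))
      (F₂ := EuclideanSpace ℝ (Fin (d + 1))) (F₃ := ℝ)
      (E₁ := (TangentSpace (𝓡∂ (d + 1)) : M → Type _))
      (E₂ := (TangentSpace (𝓡∂ (d + 1)) : M → Type _)) (E₃ := Bundle.Trivial M ℝ)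
      (b := fun x => x) (s := e.baseSet)
      g.contMDiff.contMDiffOn (hs (coordVec i)) (hs (coordVec j))
    intro x hx
    have h3 := h2 x hx
    rw [contMDiffWithinAt_totalSpace] at h3
    exact h3.2
  have h2 : ContMDiffOn 𝓘(ℝ, EuclideanSpace ℝ (Fin (d + 1))) 𝓘(ℝ, ℝ) m (metricComp g p i j)
      (extChartAt (𝓡∂ (d + 1)) p).target := by
    refine ContMDiffOn.comp (t := e.baseSet) h1 (contMDiffOn_extChartAt_symm p) ?_
    intro y hy
    have := (extChartAt (𝓡∂ (d + 1)) p).map_target hy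
    simpa [e] using this
  exact contMDiffOn_iff_contDiffOn.1 h2

lemma metricComp_symm (g : RiemMetric m d M) (p : M) (i j : Fin (d + 1))
    (y : EuclideanSpace ℝ (Fin (d + 1))) : metricComp g p i j y = metricComp g p j i y :=
  g.symm _ _ _

/-- The metric in the preferred chart around `p`, as a field of bilinear forms on the model
space. -/
def chartForm (g : RiemMetric m d M) (p : M) (y : EuclideanSpace ℝ (Fin (d + 1))) :
    EuclideanSpace ℝ (Fin (d + 1)) →L[ℝ] EuclideanSpace ℝ (Fin (d + 1)) →L[ℝ] ℝ :=
  ∑ i, ∑ j, metricComp g p i j y •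
    (EuclideanSpace.proj i : EuclideanSpace ℝ (Fin (d + 1)) →L[ℝ] ℝ).smulRight
      (EuclideanSpace.proj j : EuclideanSpace ℝ (Fin (d + 1)) →L[ℝ] ℝ)

lemma chartForm_apply (g : RiemMetric m d M) (p : M) (y v w : EuclideanSpace ℝ (Fin (d + 1))) :
    chartForm g p y v w = ∑ i, ∑ j, metricComp g p i j y * (v i * w j) := by
  simp [chartForm]

lemma chartForm_coordVec (g : RiemMetric m d M) (p : M) (y : EuclideanSpace ℝ (Fin (d + 1)))
    (i j : Fin (d + 1)) :
    chartForm g p y (coordVec i) (coordVec j) = metricComp g p i j y := by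
  simp [chartForm_apply, coordVec]

lemma sum_smul_coordVec (v : EuclideanSpace ℝ (Fin (d + 1))) : ∑ i, v i • coordVec i = v := by
  ext j
  simp [coordVec, Pi.single_apply]

set_option synthInstance.maxHeartbeats 200000 in
lemma chartForm_eq_inner (g : RiemMetric m d M) (p : M) {y : EuclideanSpace ℝ (Fin (d + 1))}
    (hy : y ∈ (extChartAt (𝓡∂ (d + 1)) p).target) (v w : EuclideanSpace ℝ (Fin (d + 1))) :
    chartForm g p y v w =
      g.inner ((extChartAt (𝓡∂ (d + 1)) p).symm y)
        ((trivializationAt (EuclideanSpace ℝ (Fin (d + 1)))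
          (TangentSpace (𝓡∂ (d + 1)) : M → Type _) p).symmL ℝ ((extChartAt (𝓡∂ (d + 1)) p).symm y) v)
        ((trivializationAt (EuclideanSpace ℝ (Fin (d + 1)))
          (TangentSpace (𝓡∂ (d + 1)) : M → Type _) p).symmL ℝ
          ((extChartAt (𝓡∂ (d + 1)) p).symm y) w) := by
  conv_rhs => rw [← sum_smul_coordVec v, ← sum_smul_coordVec w]
  simp only [map_sum, map_smul, sum_apply, smul_apply, smul_eq_mul, Finset.mul_sum]
  rw [chartForm_apply]
  rw [Finset.sum_comm]
  refine Finset.sum_congr rfl fun i _ => Finset.sum_congr rfl fun j _ => ?_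
  have h : ∀ v, (trivializationAt (EuclideanSpace ℝ (Fin (d + 1)))
      (TangentSpace (𝓡∂ (d + 1)) : M → Type _) p).symmL ℝ ((extChartAt (𝓡∂ (d + 1)) p).symm y) v =
      (trivializationAt (EuclideanSpace ℝ (Fin (d + 1)))
      (TangentSpace (𝓡∂ (d + 1)) : M → Type _) p).symm ((extChartAt (𝓡∂ (d + 1)) p).symm y) v :=
    fun v => Bundle.Trivialization.symmL_apply _ (by
      simpa using (extChartAt (𝓡∂ (d + 1)) p).map_target hy) v
  simp only [metricComp, h]
  ring

set_option synthInstance.maxHeartbeats 200000 in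
lemma contDiffOn_chartForm [h : IsManifold (𝓡∂ (d + 1)) ((m + 1 : ℕ) : WithTop ℕ∞) M]
    (g : RiemMetric m d M) (p : M) :
    ContDiffOn ℝ m (chartForm g p) (extChartAt (𝓡∂ (d + 1)) p).target := by
  refine contDiffOn_clm_apply.2 fun v => contDiffOn_clm_apply.2 fun w => ?_
  simp only [chartForm_apply]
  exact ContDiffOn.sum fun i _ => ContDiffOn.sum fun j _ =>
    (contDiffOn_metricComp g p i j).mul contDiffOn_const

lemma chartForm_symm (g : RiemMetric m d M) (p : M) (y v w : EuclideanSpace ℝ (Fin (d + 1))) :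
    chartForm g p y v w = chartForm g p y w v := by
  rw [chartForm_apply, chartForm_apply, Finset.sum_comm]
  refine Finset.sum_congr rfl fun i _ => Finset.sum_congr rfl fun j _ => ?_
  rw [metricComp_symm, mul_comm (v j)]

set_option synthInstance.maxHeartbeats 200000 in
lemma chartForm_transition (g : RiemMetric m d M) {p q x : M}
    (hp : x ∈ (extChartAt (𝓡∂ (d + 1)) p).source) (hq : x ∈ (extChartAt (𝓡∂ (d + 1)) q).source)
    (v w : EuclideanSpace ℝ (Fin (d + 1))) :
    chartForm g q (extChartAt (𝓡∂ (d + 1)) q x) v w =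
      chartForm g p (extChartAt (𝓡∂ (d + 1)) p x) (tangentCoordChange (𝓡∂ (d + 1)) q p x v)
        (tangentCoordChange (𝓡∂ (d + 1)) q p x w) := by
  rw [chartForm_eq_inner g p ((extChartAt _ p).map_source hp),
    chartForm_eq_inner g q ((extChartAt _ q).map_source hq), PartialEquiv.left_inv _ hp,
    PartialEquiv.left_inv _ hq, TangentBundle.symmL_trivializationAt_eq_core (by simpa using hq),
    TangentBundle.symmL_trivializationAt_eq_core (by simpa using hp)]
  have h := fun v : EuclideanSpace ℝ (Fin (d + 1)) =>
    tangentCoordChange_comp (I := 𝓡∂ (d + 1)) (w := q) (x := p) (y := x) (z := x) (v := v)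
    ⟨⟨hq, hp⟩, mem_extChartAt_source x⟩
  exact (congrArg₂ (fun a b => g.inner x a b) (h v) (h w)).symm

lemma chartForm_pos (g : RiemMetric m d M) (p : M) {y v : EuclideanSpace ℝ (Fin (d + 1))}
    (hy : y ∈ (extChartAt (𝓡∂ (d + 1)) p).target) (hv : v ≠ 0) : 0 < chartForm g p y v v := by
  rw [chartForm_eq_inner g p hy]
  refine g.pos _ _ fun h0 => hv ?_
  have hx : (extChartAt (𝓡∂ (d + 1)) p).symm y ∈ (trivializationAt (EuclideanSpace ℝ (Fin (d + 1)))
      (TangentSpace (𝓡∂ (d + 1)) : M → Type _) p).baseSet := by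
    simpa using (extChartAt (𝓡∂ (d + 1)) p).map_target hy
  have h1 := congrArg (Bundle.Trivialization.continuousLinearMapAt ℝ (trivializationAt
    (EuclideanSpace ℝ (Fin (d + 1))) (TangentSpace (𝓡∂ (d + 1)) : M → Type _) p) _) h0
  rwa [Bundle.Trivialization.continuousLinearMapAt_symmL _ hx, map_zero] at h1

end ChartMetric

/-! ### The second fundamental form in a chart, and its invariance -/

set_option synthInstance.maxHeartbeats 200000 in
lemma koszul_sum_left {E ι : Type*} [NormedAddCommGroup E] [NormedSpace ℝ E] (s : Finset ι)
    (T : E →L[ℝ] E →L[ℝ] E →L[ℝ] ℝ) (c : ι → ℝ) (e : ι → E) (v w : E) :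
    koszul T (∑ i ∈ s, c i • e i) v w = ∑ i ∈ s, c i * koszul T (e i) v w := by
  simp only [koszul, map_sum, map_smul, sum_apply, smul_apply, smul_eq_mul,
    ← Finset.sum_add_distrib, ← Finset.sum_sub_distrib, Finset.sum_div]
  exact Finset.sum_congr rfl fun i _ => by ring

set_option synthInstance.maxHeartbeats 200000 in
lemma koszul_sum_middle {E ι : Type*} [NormedAddCommGroup E] [NormedSpace ℝ E] (s : Finset ι)
    (T : E →L[ℝ] E →L[ℝ] E →L[ℝ] ℝ) (c : ι → ℝ) (e : ι → E) (v w : E) :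
    koszul T v (∑ i ∈ s, c i • e i) w = ∑ i ∈ s, c i * koszul T v (e i) w := by
  simp only [koszul, map_sum, map_smul, sum_apply, smul_apply, smul_eq_mul,
    ← Finset.sum_add_distrib, ← Finset.sum_sub_distrib, Finset.sum_div]
  exact Finset.sum_congr rfl fun i _ => by ring

set_option synthInstance.maxHeartbeats 200000 in
lemma koszul_sum_right {E ι : Type*} [NormedAddCommGroup E] [NormedSpace ℝ E] (s : Finset ι)
    (T : E →L[ℝ] E →L[ℝ] E →L[ℝ] ℝ) (c : ι → ℝ) (e : ι → E) (v w : E) :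
    koszul T v w (∑ i ∈ s, c i • e i) = ∑ i ∈ s, c i * koszul T v w (e i) := by
  simp only [koszul, map_sum, map_smul, sum_apply, smul_apply, smul_eq_mul,
    ← Finset.sum_add_distrib, ← Finset.sum_sub_distrib, Finset.sum_div]
  exact Finset.sum_congr rfl fun i _ => by ring

set_option synthInstance.maxHeartbeats 200000 in
lemma koszul_smul_right {E : Type*} [NormedAddCommGroup E] [NormedSpace ℝ E]
    (T : E →L[ℝ] E →L[ℝ] E →L[ℝ] ℝ) (c : ℝ) (u v w : E) :
    koszul T u v (c • w) = c * koszul T u v w := by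
  simp only [koszul, map_smul, smul_apply, smul_eq_mul]
  ring

/-! ### The unit normal in a chart -/

section ChartNormal

variable {m d : ℕ} {M : Type*} [TopologicalSpace M]
  [ChartedSpace (EuclideanHalfSpace (d + 1)) M] [IsManifold (𝓡∂ (d + 1)) 1 M]

/-- The matrix `(g_ij)` at the point of coordinates `y` in the preferred chart at `p`. -/
def gramAt (g : RiemMetric m d M) (p : M) (y : EuclideanSpace ℝ (Fin (d + 1))) :
    Matrix (Fin (d + 1)) (Fin (d + 1)) ℝ :=
  fun i j => metricComp g p i j y

/-- The matrix of the metric induced on the boundary, in the preferred chart at `p`. -/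
def boundaryGramAt (g : RiemMetric m d M) (p : M) (y : EuclideanSpace ℝ (Fin (d + 1))) :
    Matrix (Fin d) (Fin d) ℝ :=
  fun i j => gramAt g p y i.succ j.succ

/-- The unit normal in the preferred chart at `p`. -/
def normalAt (g : RiemMetric m d M) (p : M) (y : EuclideanSpace ℝ (Fin (d + 1))) :
    EuclideanSpace ℝ (Fin (d + 1)) :=
  WithLp.toLp 2 fun k => -((gramAt g p y)⁻¹ k 0) / √((gramAt g p y)⁻¹ 0 0)

/-- The second fundamental form in the preferred chart at `p`. -/
def secondFormAt (g : RiemMetric m d M) (p : M) (y : EuclideanSpace ℝ (Fin (d + 1))) :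
    Matrix (Fin d) (Fin d) ℝ :=
  fun i j => -koszul (fderivWithin ℝ (chartForm g p) (range (𝓡∂ (d + 1))) y)
    (coordVec i.succ) (coordVec j.succ) (normalAt g p y)

/-- The squared norm of the second fundamental form in the preferred chart at `p`. -/
def normSqAt (g : RiemMetric m d M) (p : M) (y : EuclideanSpace ℝ (Fin (d + 1))) : ℝ :=
  contraction (boundaryGramAt g p y) (secondFormAt g p y)

lemma dotProduct_gramAt (g : RiemMetric m d M) (p : M) (y v w : EuclideanSpace ℝ (Fin (d + 1))) :
    v.ofLp ⬝ᵥ (gramAt g p y).mulVec w.ofLp = chartForm g p y v w := by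
  simp only [dotProduct, Matrix.mulVec, chartForm_apply, gramAt, Finset.mul_sum]
  refine Finset.sum_congr rfl fun i _ => Finset.sum_congr rfl fun j _ => by ring

lemma gramAt_posDef (g : RiemMetric m d M) (p : M) {y : EuclideanSpace ℝ (Fin (d + 1))}
    (hy : y ∈ (extChartAt (𝓡∂ (d + 1)) p).target) : (gramAt g p y).PosDef := by
  refine Matrix.PosDef.of_dotProduct_mulVec_pos ?_ fun x hx => ?_
  · ext i j
    simp [gramAt, metricComp_symm g p i j]
  · have := chartForm_pos g p hy (v := WithLp.toLp 2 x) (by simpa using hx)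
    rw [← dotProduct_gramAt] at this
    simpa using this

lemma boundaryGramAt_posDef (g : RiemMetric m d M) (p : M) {y : EuclideanSpace ℝ (Fin (d + 1))}
    (hy : y ∈ (extChartAt (𝓡∂ (d + 1)) p).target) : (boundaryGramAt g p y).PosDef :=
  (gramAt_posDef g p hy).submatrix (e := Fin.succ) (Fin.succ_injective d)

lemma gramAt_inv_zero_pos (g : RiemMetric m d M) (p : M) {y : EuclideanSpace ℝ (Fin (d + 1))}
    (hy : y ∈ (extChartAt (𝓡∂ (d + 1)) p).target) : 0 < (gramAt g p y)⁻¹ 0 0 :=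
  (gramAt_posDef g p hy).inv.diag_pos

lemma normalAt_zero (g : RiemMetric m d M) (p : M) (y : EuclideanSpace ℝ (Fin (d + 1))) :
    normalAt g p y 0 = -√((gramAt g p y)⁻¹ 0 0) := by
  simp [normalAt, neg_div]

/-- Up to a scalar the normal is G⁻¹e₀, so pairing with it reads off the component `w 0`. In
particular it is orthogonal to every vector tangent to the boundary. -/
lemma chartForm_normalAt (g : RiemMetric m d M) (p : M) {y : EuclideanSpace ℝ (Fin (d + 1))}
    (hy : y ∈ (extChartAt (𝓡∂ (d + 1)) p).target) (w : EuclideanSpace ℝ (Fin (d + 1))) :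
    chartForm g p y (normalAt g p y) w = -w 0 / √((gramAt g p y)⁻¹ 0 0) := by
  rw [chartForm_symm, ← dotProduct_gramAt]
  have h1 : (normalAt g p y).ofLp =
      (-1 / √((gramAt g p y)⁻¹ 0 0)) • (gramAt g p y)⁻¹.mulVec (Pi.single 0 1) := by
    ext k
    simp [normalAt]
    ring
  rw [h1, Matrix.mulVec_smul, Matrix.mulVec_mulVec,
    Matrix.mul_nonsing_inv _ ((Matrix.isUnit_iff_isUnit_det _).1 (gramAt_posDef g p hy).isUnit),
    Matrix.one_mulVec, dotProduct_smul, dotProduct_single]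
  simp
  ring

lemma chartForm_normalAt_self (g : RiemMetric m d M) (p : M)
    {y : EuclideanSpace ℝ (Fin (d + 1))} (hy : y ∈ (extChartAt (𝓡∂ (d + 1)) p).target) :
    chartForm g p y (normalAt g p y) (normalAt g p y) = 1 := by
  have h := gramAt_inv_zero_pos g p hy
  rw [chartForm_normalAt g p hy, normalAt_zero, neg_neg, div_self (Real.sqrt_pos.2 h).ne']

/-- Subtracting from `N` the multiple of the normal with the same component 0 leaves a tangential
vector orthogonal to itself. The sign is left undetermined, since every later use is insensitive to
it. -/
lemma eq_smul_normalAt (g : RiemMetric m d M) (p : M) {y N : EuclideanSpace ℝ (Fin (d + 1))}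
    (hy : y ∈ (extChartAt (𝓡∂ (d + 1)) p).target)
    (h1 : ∀ w : EuclideanSpace ℝ (Fin (d + 1)), w 0 = 0 → chartForm g p y N w = 0)
    (h2 : chartForm g p y N N = 1) : ∃ c : ℝ, c ^ 2 = 1 ∧ N = c • normalAt g p y := by
  have hν : normalAt g p y 0 ≠ 0 := by
    rw [normalAt_zero]
    exact neg_ne_zero.2 (Real.sqrt_pos.2 (gramAt_inv_zero_pos g p hy)).ne'
  set c := N 0 / normalAt g p y 0
  set w := N - c • normalAt g p y
  have hw0 : w 0 = 0 := by simp [w, c, hν]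
  have hw : w = 0 := by
    by_contra hw
    have := chartForm_pos g p hy hw
    have h3 : chartForm g p y w w = chartForm g p y N w -
        c * chartForm g p y (normalAt g p y) w := by
      conv_lhs => enter [1, 2]; rw [show w = N - c • normalAt g p y from rfl]
      simp
    rw [h3, h1 w hw0, chartForm_normalAt g p hy, hw0] at this
    simp at this
  have hN : N = c • normalAt g p y := sub_eq_zero.1 hw
  refine ⟨c, ?_, hN⟩
  rw [hN] at h2
  simp only [map_smul, smul_apply, smul_eq_mul, chartForm_normalAt_self g p hy] at h2
  linarith [sq c]

end ChartNormal

/-! ### Change of chart at a boundary point -/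

section Transition

variable {m d : ℕ} {M : Type*} [TopologicalSpace M]
  [ChartedSpace (EuclideanHalfSpace (d + 1)) M] [IsManifold (𝓡∂ (d + 1)) 1 M]

/-- The line through `y` in a tangential direction stays in the boundary of the half space, where
`F` vanishes. This is applied to the component 0 of a transition map and to that of its derivative.
-/
lemma fderivWithin_halfSpace_tangential {F : EuclideanSpace ℝ (Fin (d + 1)) → ℝ}
    {F' : EuclideanSpace ℝ (Fin (d + 1)) →L[ℝ] ℝ} {y v : EuclideanSpace ℝ (Fin (d + 1))}
    (hF : HasFDerivWithinAt F F' (range (𝓡∂ (d + 1))) y) (hy : y 0 = 0) (hv : v 0 = 0)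
    (h0 : ∀ᶠ z in 𝓝[range (𝓡∂ (d + 1))] y, z 0 = 0 → F z = 0) : F' v = 0 := by
  have hl : HasDerivWithinAt (fun t : ℝ => y + t • v) v univ 0 := by
    simpa using (((hasDerivAt_id (0 : ℝ)).smul_const v).const_add y)
  have hm : ∀ t : ℝ, y + t • v ∈ range (𝓡∂ (d + 1)) := fun t =>
    mem_range_halfSpace.2 (by simp [hy, hv])
  have h1 : HasDerivWithinAt (F ∘ fun t : ℝ => y + t • v) (F' v) univ 0 :=
    HasFDerivWithinAt.comp_hasDerivWithinAt (t := range (𝓡∂ (d + 1))) 0 (by simpa using hF) hl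
      fun t _ => hm t
  have h2 : Filter.Tendsto (fun t : ℝ => y + t • v) (𝓝 0) (𝓝[range (𝓡∂ (d + 1))] y) := by
    refine tendsto_nhdsWithin_iff.2 ⟨?_, Filter.Eventually.of_forall hm⟩
    have : Continuous fun t : ℝ => y + t • v := by fun_prop
    simpa using this.tendsto 0
  have h3 : (F ∘ fun t : ℝ => y + t • v) =ᶠ[𝓝 0] fun _ => 0 := by
    filter_upwards [h2.eventually h0] with t ht using ht (by simp [hy, hv])
  exact (hasDerivWithinAt_univ.1 h1).unique ((hasDerivAt_const (0 : ℝ) (0 : ℝ)).congr_of_eventuallyEq h3)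

/-- The chart at `q`, read backwards, followed by the chart at `p`. -/
def transition (q p : M) : EuclideanSpace ℝ (Fin (d + 1)) → EuclideanSpace ℝ (Fin (d + 1)) :=
  extChartAt (𝓡∂ (d + 1)) p ∘ (extChartAt (𝓡∂ (d + 1)) q).symm

omit [IsManifold (𝓡∂ (d + 1)) 1 M] in
lemma eventually_mem_target_inter {p q x : M} (hp : x ∈ (extChartAt (𝓡∂ (d + 1)) p).source)
    (hq : x ∈ (extChartAt (𝓡∂ (d + 1)) q).source) :
    ∀ᶠ z in 𝓝[range (𝓡∂ (d + 1))] (extChartAt (𝓡∂ (d + 1)) q x),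
      z ∈ (extChartAt (𝓡∂ (d + 1)) q).target ∧
        (extChartAt (𝓡∂ (d + 1)) q).symm z ∈ (extChartAt (𝓡∂ (d + 1)) p).source := by
  have h1 := extChartAt_target_mem_nhdsWithin' (I := 𝓡∂ (d + 1)) hq
  have h2 := (continuousAt_extChartAt_symm' (I := 𝓡∂ (d + 1)) hq).preimage_mem_nhds
    (t := (extChartAt (𝓡∂ (d + 1)) p).source)
    (by rw [PartialEquiv.left_inv _ hq]; exact extChartAt_source_mem_nhds' hp)
  filter_upwards [h1, mem_nhdsWithin_of_mem_nhds h2] with z hz1 hz2 using ⟨hz1, hz2⟩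

lemma tangentCoordChange_apply_zero {p q x : M} (hp : x ∈ (extChartAt (𝓡∂ (d + 1)) p).source)
    (hq : x ∈ (extChartAt (𝓡∂ (d + 1)) q).source) (hx : x ∈ (𝓡∂ (d + 1)).boundary M)
    {v : EuclideanSpace ℝ (Fin (d + 1))} (hv : v 0 = 0) :
    (tangentCoordChange (𝓡∂ (d + 1)) q p x v : EuclideanSpace ℝ (Fin (d + 1))) 0 = 0 := by
  have h1 := hasFDerivWithinAt_tangentCoordChange (I := 𝓡∂ (d + 1)) ⟨hq, hp⟩
  have h2 := (EuclideanSpace.proj (0 : Fin (d + 1)) :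
    EuclideanSpace ℝ (Fin (d + 1)) →L[ℝ] ℝ).hasFDerivAt.comp_hasFDerivWithinAt _ h1
  refine fderivWithin_halfSpace_tangential h2 ((mem_boundary_iff_of_mem_source hq).1 hx) hv ?_
  filter_upwards [eventually_mem_target_inter hp hq] with z hz hz0
  refine (mem_boundary_iff_of_mem_source hz.2).1 ?_
  refine (mem_boundary_iff_of_mem_source ((extChartAt _ q).map_target hz.1)).2 ?_
  rwa [PartialEquiv.right_inv _ hz.1]

lemma tangentCoordChange_symm {p q x : M} (hp : x ∈ (extChartAt (𝓡∂ (d + 1)) p).source)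
    (hq : x ∈ (extChartAt (𝓡∂ (d + 1)) q).source) (v : EuclideanSpace ℝ (Fin (d + 1))) :
    tangentCoordChange (𝓡∂ (d + 1)) q p x (tangentCoordChange (𝓡∂ (d + 1)) p q x v) = v := by
  rw [tangentCoordChange_comp ⟨⟨hp, hq⟩, hp⟩, tangentCoordChange_self hp]

lemma tangentCoordChange_normalAt (g : RiemMetric m d M) {p q x : M}
    (hp : x ∈ (extChartAt (𝓡∂ (d + 1)) p).source)
    (hq : x ∈ (extChartAt (𝓡∂ (d + 1)) q).source) (hx : x ∈ (𝓡∂ (d + 1)).boundary M) :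
    ∃ c : ℝ, c ^ 2 = 1 ∧ tangentCoordChange (𝓡∂ (d + 1)) q p x
      (normalAt g q (extChartAt (𝓡∂ (d + 1)) q x)) =
        c • normalAt g p (extChartAt (𝓡∂ (d + 1)) p x) := by
  have hqt := (extChartAt (𝓡∂ (d + 1)) q).map_source hq
  refine eq_smul_normalAt g p ((extChartAt (𝓡∂ (d + 1)) p).map_source hp) (fun w hw => ?_) ?_
  · rw [← tangentCoordChange_symm hp hq w, ← chartForm_transition g hp hq,
      chartForm_normalAt g q hqt, tangentCoordChange_apply_zero hq hp hx hw]
    simp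
  · rw [← chartForm_transition g hp hq, chartForm_normalAt_self g q hqt]

set_option synthInstance.maxHeartbeats 200000 in
-- The non-tensorial term of `koszul_pullback` is, up to a factor, the component 0 of the second
-- derivative of the transition map on two tangential vectors. It vanishes because transition maps
-- preserve the boundary.
lemma secondFormAt_transition [h : IsManifold (𝓡∂ (d + 1)) ((m + 1 : ℕ) : WithTop ℕ∞) M]
    (hm : 1 ≤ m) (g : RiemMetric m d M) {p q x : M}
    (hp : x ∈ (extChartAt (𝓡∂ (d + 1)) p).source)
    (hq : x ∈ (extChartAt (𝓡∂ (d + 1)) q).source) (hx : x ∈ (𝓡∂ (d + 1)).boundary M) :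
    ∃ c : ℝ, c ^ 2 = 1 ∧ ∀ v w : EuclideanSpace ℝ (Fin (d + 1)), v 0 = 0 → w 0 = 0 →
      koszul (fderivWithin ℝ (chartForm g q) (range (𝓡∂ (d + 1))) (extChartAt (𝓡∂ (d + 1)) q x))
        v w (normalAt g q (extChartAt (𝓡∂ (d + 1)) q x)) =
      c * koszul (fderivWithin ℝ (chartForm g p) (range (𝓡∂ (d + 1)))
          (extChartAt (𝓡∂ (d + 1)) p x))
        (tangentCoordChange (𝓡∂ (d + 1)) q p x v) (tangentCoordChange (𝓡∂ (d + 1)) q p x w)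
        (normalAt g p (extChartAt (𝓡∂ (d + 1)) p x)) := by
  obtain ⟨c, hc, hJ⟩ := tangentCoordChange_normalAt g hp hq hx
  refine ⟨c, hc, fun v w hv hw => ?_⟩
  set I := 𝓡∂ (d + 1)
  set y := extChartAt I q x
  have hym : y ∈ range I := mem_range_self _
  have hτy : transition q p y = extChartAt I p x := by
    simp only [transition, Function.comp, y, I, PartialEquiv.left_inv _ hq]
  have hdiff : ∀ r, x ∈ (extChartAt I r).source → HasFDerivWithinAt (chartForm g r)
      (fderivWithin ℝ (chartForm g r) (range I) (extChartAt I r x)) (range I)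
      (extChartAt I r x) := by
    intro r hr
    have h1 := (contDiffOn_chartForm g r) _ ((extChartAt I r).map_source hr)
    have h2 := h1.differentiableWithinAt (by exact_mod_cast (Nat.one_le_iff_ne_zero.1 hm))
    exact (h2.mono_of_mem_nhdsWithin (extChartAt_target_mem_nhdsWithin' hr)).hasFDerivWithinAt
  have hys : y ∈ ((extChartAt I q).symm ≫ (extChartAt I p)).source := by
    rw [PartialEquiv.trans_source'', PartialEquiv.symm_symm, PartialEquiv.symm_target]
    exact mem_image_of_mem _ ⟨hq, hp⟩
  have hτ : ContDiffWithinAt ℝ ((m + 1 : ℕ) : WithTop ℕ∞) (transition q p) (range I) y :=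
    contDiffWithinAt_ext_coord_change p q hys
  have h2m : (2 : WithTop ℕ∞) ≤ ((m + 1 : ℕ) : WithTop ℕ∞) := by
    exact_mod_cast Nat.succ_le_succ hm
  have hU : UniqueDiffOn ℝ (range I) := I.uniqueDiffOn
  have hD := ((hτ.of_le h2m).fderivWithin_right (m := 1) hU (by norm_num) hym).differentiableWithinAt
    one_ne_zero |>.hasFDerivWithinAt
  -- The point lies on the edge of the half space; symmetry of the second derivative there uses that
  -- it is in the closure of the interior.
  have hsymm : IsSymmSndFDerivWithinAt ℝ (transition q p) (range I) y := by
    refine hτ.isSymmSndFDerivWithinAt (by simpa using h2m) hU ?_ hym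
    exact I.range_subset_closure_interior hym
  have hDz : ∀ x' ∈ (extChartAt I q).source, x' ∈ (extChartAt I p).source →
      fderivWithin ℝ (transition q p) (range I) (extChartAt I q x') =
        tangentCoordChange I q p x' := fun x' h1 h2 => rfl
  have hev := eventually_mem_target_inter (d := d) hp hq
  have key := koszul_pullback (B := chartForm g p) (Bq := chartForm g q) (τ := transition q p)
    (D := fderivWithin ℝ (transition q p) (range I)) (s := range I) (y := y)
    (hU y hym) hym (by rw [hτy]; exact hdiff p hp) (hdiff q hq)
    (hτ.differentiableWithinAt (by simp)).hasFDerivWithinAt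
    (fun z hz => hz.2) (Filter.Eventually.of_forall fun z => mem_range_self _) hD
    (fun u v => hsymm u v) (fun u v => chartForm_symm g p _ u v)
    (by
      filter_upwards [hev] with z hz v w
      have h1 := chartForm_transition g hz.2 ((extChartAt I q).map_target hz.1) v w
      rw [PartialEquiv.right_inv _ hz.1] at h1
      rw [h1, ← hDz _ ((extChartAt I q).map_target hz.1) hz.2, PartialEquiv.right_inv _ hz.1]
      rfl)
    v w (normalAt g q y)
  have hDy : fderivWithin ℝ (transition q p) (range I) y = tangentCoordChange I q p x :=
    hDz x hq hp
  -- Along the boundary the first derivative maps the tangential vector `w` to tangential vectors;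
  -- this is differentiated in the tangential direction `v`.
  have hD2 : fderivWithin ℝ (fderivWithin ℝ (transition q p) (range I)) (range I) y v w 0 = 0 := by
    have h1 := (EuclideanSpace.proj (0 : Fin (d + 1)) :
      EuclideanSpace ℝ (Fin (d + 1)) →L[ℝ] ℝ).hasFDerivAt.comp_hasFDerivWithinAt _
        (hD.clm_apply (hasFDerivWithinAt_const w y (range I)))
    have h2 := fderivWithin_halfSpace_tangential h1 ((mem_boundary_iff_of_mem_source hq).1 hx) hv ?_
    · simpa using h2
    · filter_upwards [hev] with z hz hz0
      have h3 := hDz _ ((extChartAt I q).map_target hz.1) hz.2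
      rw [PartialEquiv.right_inv _ hz.1] at h3
      simp only [Function.comp, h3]
      refine tangentCoordChange_apply_zero hz.2 ((extChartAt I q).map_target hz.1) ?_ hw
      refine (mem_boundary_iff_of_mem_source ((extChartAt I q).map_target hz.1)).2 ?_
      rwa [PartialEquiv.right_inv _ hz.1]
  rw [key, hτy, hDy, hJ, map_smul, chartForm_symm,
    chartForm_normalAt g p ((extChartAt I p).map_source hp), hD2,
    neg_zero, zero_div, smul_zero, add_zero, koszul_smul_right]

/-- The matrix of the differential of the transition map between the boundary coordinates. -/
def boundaryJacobian (q p x : M) : Matrix (Fin d) (Fin d) ℝ :=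
  fun a b => (tangentCoordChange (𝓡∂ (d + 1)) q p x (coordVec b.succ) :
    EuclideanSpace ℝ (Fin (d + 1))) a.succ

lemma tangentCoordChange_coordVec {p q x : M} (hp : x ∈ (extChartAt (𝓡∂ (d + 1)) p).source)
    (hq : x ∈ (extChartAt (𝓡∂ (d + 1)) q).source) (hx : x ∈ (𝓡∂ (d + 1)).boundary M)
    (b : Fin d) :
    tangentCoordChange (𝓡∂ (d + 1)) q p x (coordVec b.succ) =
      ∑ a, boundaryJacobian q p x a b • coordVec (d := d) a.succ := by
  have h := sum_smul_coordVec (d := d)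
    (tangentCoordChange (𝓡∂ (d + 1)) q p x (coordVec b.succ))
  rw [Fin.sum_univ_succ, tangentCoordChange_apply_zero hp hq hx (by simp [coordVec]), zero_smul,
    zero_add] at h
  exact h.symm

lemma boundaryGramAt_transition (g : RiemMetric m d M) {p q x : M}
    (hp : x ∈ (extChartAt (𝓡∂ (d + 1)) p).source)
    (hq : x ∈ (extChartAt (𝓡∂ (d + 1)) q).source) (hx : x ∈ (𝓡∂ (d + 1)).boundary M) :
    boundaryGramAt g q (extChartAt (𝓡∂ (d + 1)) q x) =
      (boundaryJacobian q p x).transpose *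
        boundaryGramAt g p (extChartAt (𝓡∂ (d + 1)) p x) * boundaryJacobian q p x := by
  ext i j
  have h1 : boundaryGramAt g q (extChartAt (𝓡∂ (d + 1)) q x) i j =
    chartForm g q (extChartAt (𝓡∂ (d + 1)) q x) (coordVec i.succ) (coordVec j.succ) :=
    (chartForm_coordVec _ _ _ _ _).symm
  rw [h1, chartForm_transition g hp hq, tangentCoordChange_coordVec hp hq hx,
    tangentCoordChange_coordVec hp hq hx]
  simp only [map_sum, map_smul, sum_apply, smul_apply, smul_eq_mul, chartForm_coordVec,
    Matrix.mul_apply, Matrix.transpose_apply, Finset.sum_mul, Finset.mul_sum]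
  refine Finset.sum_congr rfl fun a _ => Finset.sum_congr rfl fun b _ => ?_
  simp only [boundaryGramAt, gramAt]
  ring

lemma normSqAt_transition [h : IsManifold (𝓡∂ (d + 1)) ((m + 1 : ℕ) : WithTop ℕ∞) M]
    (hm : 1 ≤ m) (g : RiemMetric m d M) {p q x : M}
    (hp : x ∈ (extChartAt (𝓡∂ (d + 1)) p).source)
    (hq : x ∈ (extChartAt (𝓡∂ (d + 1)) q).source) (hx : x ∈ (𝓡∂ (d + 1)).boundary M) :
    normSqAt g q (extChartAt (𝓡∂ (d + 1)) q x) = normSqAt g p (extChartAt (𝓡∂ (d + 1)) p x) := by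
  obtain ⟨c, hc, hk⟩ := secondFormAt_transition hm g hp hq hx
  have h1 : secondFormAt g q (extChartAt (𝓡∂ (d + 1)) q x) =
      c • ((boundaryJacobian q p x).transpose *
        secondFormAt g p (extChartAt (𝓡∂ (d + 1)) p x) * boundaryJacobian q p x) := by
    ext i j
    rw [secondFormAt, hk _ _ (by simp [coordVec]) (by simp [coordVec]),
      tangentCoordChange_coordVec hp hq hx, tangentCoordChange_coordVec hp hq hx, koszul_sum_left]
    simp only [koszul_sum_middle, Matrix.smul_apply, smul_eq_mul,
      Matrix.mul_apply, Matrix.transpose_apply, Finset.sum_mul, Finset.mul_sum,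
      ← Finset.sum_neg_distrib]
    rw [Finset.sum_comm]
    refine Finset.sum_congr rfl fun a _ => Finset.sum_congr rfl fun b _ => ?_
    simp only [secondFormAt]
    ring
  rw [normSqAt, normSqAt, boundaryGramAt_transition g hp hq hx, h1]
  refine contraction_congr hc fun h0 => ?_
  -- The Jacobian is invertible: otherwise the boundary Gram matrix in the chart at `q` would be
  -- singular.
  have h2 := (boundaryGramAt_posDef g q ((extChartAt (𝓡∂ (d + 1)) q).map_source hq)).det_pos
  rw [boundaryGramAt_transition g hp hq hx, Matrix.det_mul, h0, mul_zero] at h2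
  exact h2.false

end Transition

/-! ### Conformal changes -/

section Conformal

variable {m d : ℕ} {M : Type*} [TopologicalSpace M]
  [ChartedSpace (EuclideanHalfSpace (d + 1)) M] [IsManifold (𝓡∂ (d + 1)) 1 M]

set_option synthInstance.maxHeartbeats 200000 in
lemma hasFDerivWithinAt_chartForm [h : IsManifold (𝓡∂ (d + 1)) ((m + 1 : ℕ) : WithTop ℕ∞) M]
    (hm : 1 ≤ m) (g : RiemMetric m d M) (p : M) {y : EuclideanSpace ℝ (Fin (d + 1))}
    (hy : y ∈ (extChartAt (𝓡∂ (d + 1)) p).target) :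
    HasFDerivWithinAt (chartForm g p) (fderivWithin ℝ (chartForm g p) (range (𝓡∂ (d + 1))) y)
      (range (𝓡∂ (d + 1))) y := by
  have h2 := ((contDiffOn_chartForm g p) y hy).differentiableWithinAt
    (by exact_mod_cast (Nat.one_le_iff_ne_zero.1 hm))
  exact (h2.mono_of_mem_nhdsWithin (extChartAt_target_mem_nhdsWithin_of_mem hy)).hasFDerivWithinAt

set_option synthInstance.maxHeartbeats 200000 in
lemma metricDeriv_eq [h : IsManifold (𝓡∂ (d + 1)) ((m + 1 : ℕ) : WithTop ℕ∞) M]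
    (hm : 1 ≤ m) (g : RiemMetric m d M) (p : M) (k i j : Fin (d + 1)) :
    metricDeriv g p k i j = fderivWithin ℝ (chartForm g p) (range (𝓡∂ (d + 1)))
      (extChartAt (𝓡∂ (d + 1)) p p) (coordVec k) (coordVec i) (coordVec j) := by
  have h1 := hasFDerivWithinAt_chartForm hm g p (mem_extChartAt_target p)
  have h2 := (h1.clm_apply (hasFDerivWithinAt_const (coordVec i) _ _)).clm_apply
    (hasFDerivWithinAt_const (coordVec j) _ _)
  simp only [chartForm_coordVec] at h2
  rw [metricDeriv]
  erw [h2.fderivWithin ((𝓡∂ (d + 1)).uniqueDiffOn _ (mem_range_self _))]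
  simp

lemma christoffel_eq [h : IsManifold (𝓡∂ (d + 1)) ((m + 1 : ℕ) : WithTop ℕ∞) M]
    (hm : 1 ≤ m) (g : RiemMetric m d M) (p : M) (i j k : Fin (d + 1)) :
    christoffel g p i j k = koszul (fderivWithin ℝ (chartForm g p) (range (𝓡∂ (d + 1)))
      (extChartAt (𝓡∂ (d + 1)) p p)) (coordVec i) (coordVec j) (coordVec k) := by
  simp only [christoffel, metricDeriv_eq hm, koszul]

lemma secondFundamentalForm_eq [h : IsManifold (𝓡∂ (d + 1)) ((m + 1 : ℕ) : WithTop ℕ∞) M]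
    (hm : 1 ≤ m) (g : RiemMetric m d M) (p : M) :
    secondFundamentalForm g p = secondFormAt g p (extChartAt (𝓡∂ (d + 1)) p p) := by
  ext i j
  rw [secondFormAt, ← sum_smul_coordVec (normalAt g p _), koszul_sum_right]
  simp only [secondFundamentalForm, christoffel_eq hm]
  congr 1
  exact Finset.sum_congr rfl fun k _ => mul_comm _ _

lemma normSq_eq [h : IsManifold (𝓡∂ (d + 1)) ((m + 1 : ℕ) : WithTop ℕ∞) M]
    (hm : 1 ≤ m) (g : RiemMetric m d M) (p : M) :
    normSqSecondFundamentalForm g p = normSqAt g p (extChartAt (𝓡∂ (d + 1)) p p) := by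
  rw [normSqSecondFundamentalForm, secondFundamentalForm_eq hm]
  rfl

lemma normSq_eq_of_mem_source [h : IsManifold (𝓡∂ (d + 1)) ((m + 1 : ℕ) : WithTop ℕ∞) M]
    (hm : 1 ≤ m) (g : RiemMetric m d M) {p x : M}
    (hx : x ∈ (extChartAt (𝓡∂ (d + 1)) p).source) (hb : x ∈ (𝓡∂ (d + 1)).boundary M) :
    normSqSecondFundamentalForm g x = normSqAt g p (extChartAt (𝓡∂ (d + 1)) p x) := by
  rw [normSq_eq hm, normSqAt_transition hm g hx (mem_extChartAt_source x) hb]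

lemma normSq_pos [h : IsManifold (𝓡∂ (d + 1)) ((m + 1 : ℕ) : WithTop ℕ∞) M]
    (hm : 1 ≤ m) (g : RiemMetric m d M) {p : M} (hp : secondFundamentalForm g p ≠ 0) :
    0 < normSqSecondFundamentalForm g p := by
  rw [normSq_eq hm]
  refine contraction_pos (boundaryGramAt_posDef g p (mem_extChartAt_target p)) ?_
  rwa [← secondFundamentalForm_eq hm]

/-- The differential of `u` at `p`, in the preferred chart at `p`. -/
def coordDiff {d : ℕ} {M : Type*} [TopologicalSpace M]
    [ChartedSpace (EuclideanHalfSpace (d + 1)) M] (u : M → ℝ) (p : M) :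
    EuclideanSpace ℝ (Fin (d + 1)) →L[ℝ] ℝ :=
  mfderiv (𝓡∂ (d + 1)) 𝓘(ℝ, ℝ) u p

variable (g : RiemMetric m d M) (u : C^m⟮𝓡∂ (d + 1), M; 𝓘(ℝ, ℝ), ℝ⟯) (p : M)

lemma metricComp_conformalMetric (i j : Fin (d + 1)) (y : EuclideanSpace ℝ (Fin (d + 1))) :
    metricComp (conformalMetric g u) p i j y =
      Real.exp (2 * u ((extChartAt (𝓡∂ (d + 1)) p).symm y)) * metricComp g p i j y := by
  simp only [metricComp, conformalMetric, smul_apply, smul_eq_mul]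

lemma chartForm_conformalMetric (y v w : EuclideanSpace ℝ (Fin (d + 1))) :
    chartForm (conformalMetric g u) p y v w =
      Real.exp (2 * u ((extChartAt (𝓡∂ (d + 1)) p).symm y)) * chartForm g p y v w := by
  simp only [chartForm_apply, metricComp_conformalMetric, Finset.mul_sum, mul_assoc]

lemma gramAt_conformalMetric (y : EuclideanSpace ℝ (Fin (d + 1))) :
    gramAt (conformalMetric g u) p y =
      Real.exp (2 * u ((extChartAt (𝓡∂ (d + 1)) p).symm y)) • gramAt g p y := by
  ext i j
  simp [gramAt, metricComp_conformalMetric]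

lemma boundaryGramAt_conformalMetric (y : EuclideanSpace ℝ (Fin (d + 1))) :
    boundaryGramAt (conformalMetric g u) p y =
      Real.exp (2 * u ((extChartAt (𝓡∂ (d + 1)) p).symm y)) • boundaryGramAt g p y := by
  ext i j
  simp [boundaryGramAt, gramAt, metricComp_conformalMetric]

lemma normalAt_conformalMetric (y : EuclideanSpace ℝ (Fin (d + 1))) :
    normalAt (conformalMetric g u) p y =
      Real.exp (-u ((extChartAt (𝓡∂ (d + 1)) p).symm y)) • normalAt g p y := by
  set t := u ((extChartAt (𝓡∂ (d + 1)) p).symm y)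
  have h1 : (Real.exp (2 * t))⁻¹ = Real.exp (-t) ^ 2 := by
    rw [← Real.exp_neg, sq, ← Real.exp_add]; ring_nf
  ext k
  simp only [normalAt, gramAt_conformalMetric, PiLp.smul_apply, smul_eq_mul]
  rw [inv_smul_matrix _ (Real.exp_pos _).ne', h1]
  simp only [Matrix.smul_apply, smul_eq_mul]
  rw [Real.sqrt_mul (sq_nonneg _), Real.sqrt_sq (Real.exp_pos _).le]
  have := (Real.exp_pos (-t)).ne'
  field_simp

omit [IsManifold (𝓡∂ (d + 1)) 1 M] in
lemma hasFDerivWithinAt_chartRep (hm : 1 ≤ m) (x : M) :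
    HasFDerivWithinAt (fun y => u ((extChartAt (𝓡∂ (d + 1)) x).symm y))
      (coordDiff u x)
      (range (𝓡∂ (d + 1))) (extChartAt (𝓡∂ (d + 1)) x x) := by
  have h1 : MDifferentiableAt (𝓡∂ (d + 1)) 𝓘(ℝ, ℝ) u x :=
    u.contMDiff.mdifferentiableAt (by exact_mod_cast (Nat.one_le_iff_ne_zero.1 hm))
  exact h1.hasMFDerivAt.2

set_option synthInstance.maxHeartbeats 200000 in
-- The derivative of e^{2u}g is e^{2u}(∂g + 2 du ⊗ g); the factor 2 cancels the denominator of
-- `koszul`.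
lemma koszul_conformalMetric [h : IsManifold (𝓡∂ (d + 1)) ((m + 1 : ℕ) : WithTop ℕ∞) M]
    (hm : 1 ≤ m) (a b c : EuclideanSpace ℝ (Fin (d + 1))) :
    koszul (fderivWithin ℝ (chartForm (conformalMetric g u) p) (range (𝓡∂ (d + 1)))
      (extChartAt (𝓡∂ (d + 1)) p p)) a b c =
    Real.exp (2 * u p) * (koszul (fderivWithin ℝ (chartForm g p) (range (𝓡∂ (d + 1)))
      (extChartAt (𝓡∂ (d + 1)) p p)) a b c +
      coordDiff u p a *
        chartForm g p (extChartAt (𝓡∂ (d + 1)) p p) b c +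
      coordDiff u p b *
        chartForm g p (extChartAt (𝓡∂ (d + 1)) p p) a c -
      coordDiff u p c *
        chartForm g p (extChartAt (𝓡∂ (d + 1)) p p) a b) := by
  set U := coordDiff (d := d) u p
  have hu := hasFDerivWithinAt_chartRep u hm p
  have key : ∀ a b c : EuclideanSpace ℝ (Fin (d + 1)),
      fderivWithin ℝ (chartForm (conformalMetric g u) p) (range (𝓡∂ (d + 1)))
        (extChartAt (𝓡∂ (d + 1)) p p) a b c =
      Real.exp (2 * u p) * (fderivWithin ℝ (chartForm g p) (range (𝓡∂ (d + 1)))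
        (extChartAt (𝓡∂ (d + 1)) p p) a b c +
        2 * U a * chartForm g p (extChartAt (𝓡∂ (d + 1)) p p) b c) := by
    intro a b c
    have h1 := ((hasFDerivWithinAt_chartForm hm (conformalMetric g u) p
      (mem_extChartAt_target p)).clm_apply (hasFDerivWithinAt_const b _ _)).clm_apply
      (hasFDerivWithinAt_const c _ _)
    have h2 := (hu.const_mul 2).exp.mul (((hasFDerivWithinAt_chartForm hm g p
      (mem_extChartAt_target p)).clm_apply (hasFDerivWithinAt_const b _ _)).clm_apply
      (hasFDerivWithinAt_const c _ _))
    simp only [chartForm_conformalMetric] at h1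
    have h3 := DFunLike.congr_fun (((𝓡∂ (d + 1)).uniqueDiffOn _ (mem_range_self _)).eq h1 h2) a
    simp only [extChartAt_to_inv] at h3
    simp only [add_apply, smul_apply, smul_eq_mul, ContinuousLinearMap.flip_apply,
      ContinuousLinearMap.comp_apply, zero_apply, map_zero, zero_add] at h3
    linarith
  simp only [koszul, key]
  ring

/-- With tangential first two arguments and the normal as the third, two of the three correction
terms contain g(∂ᵢ, ν) = 0. The remaining one gives the normal derivative, and the rescaled normal
turns e^{2u} into e^u. -/
lemma secondFormAt_conformalMetric [h : IsManifold (𝓡∂ (d + 1)) ((m + 1 : ℕ) : WithTop ℕ∞) M]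
    (hm : 1 ≤ m) :
    secondFormAt (conformalMetric g u) p (extChartAt (𝓡∂ (d + 1)) p p) =
      Real.exp (u p) • (secondFormAt g p (extChartAt (𝓡∂ (d + 1)) p p) +
        normalDeriv g u p • boundaryGramAt g p (extChartAt (𝓡∂ (d + 1)) p p)) := by
  ext i j
  have hN : ∀ k : Fin d, chartForm g p (extChartAt (𝓡∂ (d + 1)) p p) (coordVec k.succ)
      (normalAt g p (extChartAt (𝓡∂ (d + 1)) p p)) = 0 := fun k => by
    rw [chartForm_symm, chartForm_normalAt g p (mem_extChartAt_target p)]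
    simp [coordVec]
  have he : Real.exp (u p) = Real.exp (-u p) * Real.exp (2 * u p) := by
    rw [← Real.exp_add]; ring_nf
  rw [secondFormAt, normalAt_conformalMetric, koszul_smul_right, koszul_conformalMetric g u p hm,
    hN, hN, chartForm_coordVec, extChartAt_to_inv]
  simp only [Matrix.smul_apply, Matrix.add_apply, smul_eq_mul, secondFormAt, he, boundaryGramAt,
    gramAt]
  have : normalDeriv g u p = coordDiff u p (normalAt g p (extChartAt (𝓡∂ (d + 1)) p p)) := rfl
  rw [this]
  ring

lemma meanCurvature_conformalMetric [h : IsManifold (𝓡∂ (d + 1)) ((m + 1 : ℕ) : WithTop ℕ∞) M]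
    (hm : 1 ≤ m) :
    meanCurvature (conformalMetric g u) p =
      Real.exp (-u p) * (meanCurvature g p + d * normalDeriv g u p) := by
  -- The trace of G⁻¹G, after using the symmetry of `G`; it produces the factor `d` of the normal
  -- derivative.
  have hd : ∑ i, ∑ j, (boundaryGram g p)⁻¹ i j * boundaryGram g p i j = d := by
    have h1 := (boundaryGramAt_posDef g p (mem_extChartAt_target p))
    have h2 := Matrix.nonsing_inv_mul _ ((Matrix.isUnit_iff_isUnit_det _).1 h1.isUnit)
    have h3 := congrArg Matrix.trace h2
    rw [Matrix.trace_one, Fintype.card_fin] at h3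
    rw [← h3]
    simp only [Matrix.trace, Matrix.diag, Matrix.mul_apply]
    refine Finset.sum_congr rfl fun i _ => Finset.sum_congr rfl fun j _ => ?_
    congr 1
    exact metricComp_symm g p _ _ _
  have he : Real.exp (-u p) = (Real.exp (2 * u p))⁻¹ * Real.exp (u p) := by
    rw [← Real.exp_neg, ← Real.exp_add]; ring_nf
  have hb : boundaryGram (conformalMetric g u) p = Real.exp (2 * u p) • boundaryGram g p := by
    have := boundaryGramAt_conformalMetric g u p (extChartAt (𝓡∂ (d + 1)) p p)
    rwa [extChartAt_to_inv] at this
  simp only [meanCurvature]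
  rw [hb, inv_smul_matrix _ (Real.exp_pos _).ne', secondFundamentalForm_eq hm,
    secondFormAt_conformalMetric g u p hm, ← secondFundamentalForm_eq hm]
  simp only [Matrix.smul_apply, Matrix.add_apply, smul_eq_mul]
  rw [← hd, he, mul_add, Finset.sum_mul, Finset.mul_sum, Finset.mul_sum, ← Finset.sum_add_distrib]
  refine Finset.sum_congr rfl fun i _ => ?_
  rw [Finset.sum_mul, Finset.mul_sum, Finset.mul_sum, ← Finset.sum_add_distrib]
  refine Finset.sum_congr rfl fun j _ => ?_
  change _ * (_ * (_ + _ * boundaryGram g p i j)) = _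
  ring

lemma normSq_conformalMetric [h : IsManifold (𝓡∂ (d + 1)) ((m + 1 : ℕ) : WithTop ℕ∞) M]
    (hm : 1 ≤ m) (hu : normalDeriv g u p = 0) :
    normSqSecondFundamentalForm (conformalMetric g u) p =
      Real.exp (-2 * u p) * normSqSecondFundamentalForm g p := by
  rw [normSq_eq hm, normSq_eq hm, normSqAt, secondFormAt_conformalMetric g u p hm, hu, zero_smul,
    add_zero, boundaryGramAt_conformalMetric, extChartAt_to_inv,
    contraction_smul _ _ (Real.exp_pos _).ne', ← Real.exp_sub, sq, ← Real.exp_add]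
  ring_nf
  rfl

lemma hasMinimalBoundary_conformalMetric_iff
    [h : IsManifold (𝓡∂ (d + 1)) ((m + 1 : ℕ) : WithTop ℕ∞) M]
    (hm : 1 ≤ m) (hd : d ≠ 0) (hg : HasMinimalBoundary g) :
    HasMinimalBoundary (conformalMetric g u) ↔
      ∀ p ∈ (𝓡∂ (d + 1)).boundary M, normalDeriv g u p = 0 := by
  refine forall₂_congr fun p hp => ?_
  rw [meanCurvature_conformalMetric g u p hm, hg p hp, zero_add]
  simp [hd]

lemma mem_minimalConformalClass_iff
    [h : IsManifold (𝓡∂ (d + 1)) ((m + 1 : ℕ) : WithTop ℕ∞) M]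
    (hm : 1 ≤ m) (hd : d ≠ 0) (hg : HasMinimalBoundary g) (g' : RiemMetric m d M) :
    g' ∈ minimalConformalClass g ↔ ∃ u : C^m⟮𝓡∂ (d + 1), M; 𝓘(ℝ, ℝ), ℝ⟯,
      (∀ p ∈ (𝓡∂ (d + 1)).boundary M, normalDeriv g u p = 0) ∧ g' = conformalMetric g u := by
  constructor
  · rintro ⟨⟨u, rfl⟩, h'⟩
    exact ⟨u, (hasMinimalBoundary_conformalMetric_iff g u hm hd hg).1 h', rfl⟩
  · rintro ⟨u, hu, rfl⟩
    exact ⟨⟨u, rfl⟩, (hasMinimalBoundary_conformalMetric_iff g u hm hd hg).2 hu⟩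

end Conformal

/-! ### Smoothness of the squared norm of the second fundamental form -/

section MatrixSmooth

variable {E : Type*} [NormedAddCommGroup E] [NormedSpace ℝ E] {k : ℕ} {n : WithTop ℕ∞} {s : Set E}

lemma contDiffOn_det {A : E → Matrix (Fin k) (Fin k) ℝ}
    (hA : ∀ i j, ContDiffOn ℝ n (fun x => A x i j) s) : ContDiffOn ℝ n (fun x => (A x).det) s := by
  simp only [Matrix.det_apply]
  refine ContDiffOn.sum fun σ _ => ?_
  have h1 : ContDiffOn ℝ n (fun x => ∏ i, A x (σ i) i) s := contDiffOn_prod fun i _ => hA _ _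
  simpa only [Units.smul_def, zsmul_eq_mul] using contDiffOn_const.mul h1

lemma contDiffOn_matrix_inv {A : E → Matrix (Fin k) (Fin k) ℝ}
    (hA : ∀ i j, ContDiffOn ℝ n (fun x => A x i j) s) (h0 : ∀ x ∈ s, (A x).det ≠ 0) (i j : Fin k) :
    ContDiffOn ℝ n (fun x => (A x)⁻¹ i j) s := by
  have h1 : ContDiffOn ℝ n (fun x => (A x).adjugate i j) s := by
    simp only [Matrix.adjugate_apply]
    refine contDiffOn_det fun a b => ?_
    by_cases hab : a = j
    · subst hab
      simp only [Matrix.updateRow_self]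
      exact contDiffOn_const
    · simpa only [Matrix.updateRow_ne hab] using hA a b
  refine ((contDiffOn_det hA).inv h0 |>.mul h1).congr fun x hx => ?_
  rw [Matrix.inv_def, Matrix.smul_apply, Ring.inverse_eq_inv', smul_eq_mul]
  rfl

set_option synthInstance.maxHeartbeats 200000 in
-- One derivative is lost, by differentiating the metric.
lemma contDiffOn_koszul {m : WithTop ℕ∞} {B : E → E →L[ℝ] E →L[ℝ] ℝ} {N : E → E}
    (hB : ContDiffOn ℝ m B s) (hs : UniqueDiffOn ℝ s) (hnm : n + 1 ≤ m) (hN : ContDiffOn ℝ n N s)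
    (v w : E) : ContDiffOn ℝ n (fun y => koszul (fderivWithin ℝ B s y) v w (N y)) s := by
  have hT := hB.fderivWithin hs hnm
  have h3 : ∀ a b c : E → E, ContDiffOn ℝ n a s → ContDiffOn ℝ n b s → ContDiffOn ℝ n c s →
      ContDiffOn ℝ n (fun y => fderivWithin ℝ B s y (a y) (b y) (c y)) s :=
    fun a b c ha hb hc => ((hT.clm_apply ha).clm_apply hb).clm_apply hc
  simp only [koszul]
  exact (((h3 _ _ _ contDiffOn_const contDiffOn_const hN).add
    (h3 _ _ _ contDiffOn_const contDiffOn_const hN)).sub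
    (h3 _ _ _ hN contDiffOn_const contDiffOn_const)).div_const 2

end MatrixSmooth

/-! ### The squared norm in boundary coordinates -/

section Smoothness

variable {m n d : ℕ} {M : Type*} [TopologicalSpace M]
  [ChartedSpace (EuclideanHalfSpace (d + 1)) M] [IsManifold (𝓡∂ (d + 1)) 1 M]
  [h : IsManifold (𝓡∂ (d + 1)) ((m + 1 : ℕ) : WithTop ℕ∞) M]

lemma contDiffOn_gramAt_inv (g : RiemMetric m d M) (p : M) (i j : Fin (d + 1)) :
    ContDiffOn ℝ m (fun y => (gramAt g p y)⁻¹ i j) (extChartAt (𝓡∂ (d + 1)) p).target :=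
  contDiffOn_matrix_inv (fun i j => contDiffOn_metricComp g p i j)
    (fun _ hy => (gramAt_posDef g p hy).det_pos.ne') i j

lemma contDiffOn_normalAt (g : RiemMetric m d M) (p : M) :
    ContDiffOn ℝ m (normalAt g p) (extChartAt (𝓡∂ (d + 1)) p).target := by
  refine contDiffOn_euclidean.2 fun k => ?_
  exact (contDiffOn_gramAt_inv g p k 0).neg.div
    ((contDiffOn_gramAt_inv g p 0 0).sqrt fun y hy => (gramAt_inv_zero_pos g p hy).ne')
    fun y hy => (Real.sqrt_pos.2 (gramAt_inv_zero_pos g p hy)).ne'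

set_option synthInstance.maxHeartbeats 200000 in
lemma contDiffOn_secondFormAt (hn : n + 1 ≤ m) (g : RiemMetric m d M) (p : M) (i j : Fin d) :
    ContDiffOn ℝ n (fun y => secondFormAt g p y i j) (extChartAt (𝓡∂ (d + 1)) p).target := by
  have hU := uniqueDiffOn_extChartAt_target (I := 𝓡∂ (d + 1)) p
  have hnm : (n : WithTop ℕ∞) + 1 ≤ (m : WithTop ℕ∞) := by exact_mod_cast hn
  have hN : ContDiffOn ℝ n (normalAt g p) (extChartAt (𝓡∂ (d + 1)) p).target :=
    (contDiffOn_normalAt g p).of_le (le_self_add.trans hnm)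
  refine (contDiffOn_koszul (contDiffOn_chartForm g p) hU hnm hN (coordVec i.succ)
    (coordVec j.succ)).neg.congr fun y hy => ?_
  -- The derivative in the definition is taken within the half space; near `y` that set coincides
  -- with the chart target.
  rw [secondFormAt, fderivWithin_congr_set (extChartAt_target_eventuallyEq_of_mem hy)]

lemma contDiffOn_normSqAt (hn : n + 1 ≤ m) (g : RiemMetric m d M) (p : M) :
    ContDiffOn ℝ n (normSqAt g p) (extChartAt (𝓡∂ (d + 1)) p).target := by
  have hnm : (n : WithTop ℕ∞) ≤ (m : WithTop ℕ∞) := by exact_mod_cast (Nat.le_of_succ_le hn)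
  have hG : ∀ i j, ContDiffOn ℝ n (fun y => (boundaryGramAt g p y)⁻¹ i j)
      (extChartAt (𝓡∂ (d + 1)) p).target :=
    contDiffOn_matrix_inv (fun i j => (contDiffOn_metricComp g p i.succ j.succ).of_le hnm)
      (fun _ hy => (boundaryGramAt_posDef g p hy).det_pos.ne')
  have hS := contDiffOn_secondFormAt hn g p
  unfold normSqAt contraction
  refine ContDiffOn.sum fun i _ => ContDiffOn.sum fun j _ => ContDiffOn.sum fun k _ =>
    ContDiffOn.sum fun l _ => ?_
  exact (((hG i k).mul (hG j l)).mul (hS i j)).mul (hS k l)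

/-- The inclusion `y ↦ (0, y)` of the boundary of the half space. -/
def boundaryIncl (d : ℕ) : EuclideanSpace ℝ (Fin d) →L[ℝ] EuclideanSpace ℝ (Fin (d + 1)) :=
  LinearMap.toContinuousLinearMap
    { toFun := fun y => WithLp.toLp 2 (Fin.cons 0 y.ofLp)
      map_add' := fun y z => by
        ext i
        refine Fin.cases ?_ (fun i => ?_) i <;> simp
      map_smul' := fun c y => by
        ext i
        refine Fin.cases ?_ (fun i => ?_) i <;> simp }

@[simp] lemma boundaryIncl_zero (y : EuclideanSpace ℝ (Fin d)) : boundaryIncl d y 0 = 0 := rfl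

@[simp] lemma boundaryIncl_succ (y : EuclideanSpace ℝ (Fin d)) (i : Fin d) :
    boundaryIncl d y i.succ = y i := rfl

lemma norm_boundaryIncl (y : EuclideanSpace ℝ (Fin d)) : ‖boundaryIncl d y‖ = ‖y‖ := by
  simp [EuclideanSpace.norm_eq, Fin.sum_univ_succ]

omit [IsManifold (𝓡∂ (d + 1)) 1 M] h in
lemma boundaryIncl_boundaryCoord {p : M} (hp : extChartAt (𝓡∂ (d + 1)) p p 0 = 0) :
    boundaryIncl d (boundaryCoord d p) = extChartAt (𝓡∂ (d + 1)) p p := by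
  ext i
  refine Fin.cases ?_ (fun i => ?_) i
  · exact hp.symm
  · rfl

/-- The domain of the boundary coordinates given by the preferred chart at `p`. -/
def boundaryDomain (d : ℕ) {M : Type*} [TopologicalSpace M]
    [ChartedSpace (EuclideanHalfSpace (d + 1)) M] (p : M) : Set (EuclideanSpace ℝ (Fin d)) :=
  boundaryIncl d ⁻¹' (extChartAt (𝓡∂ (d + 1)) p).target

omit [IsManifold (𝓡∂ (d + 1)) 1 M] h in
lemma isOpen_boundaryDomain (p : M) : IsOpen (boundaryDomain d p) := by
  refine isOpen_iff_mem_nhds.2 fun y hy => ?_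
  have h1 := extChartAt_target_mem_nhdsWithin_of_mem (I := 𝓡∂ (d + 1)) hy
  refine (tendsto_nhdsWithin_iff.2 ⟨(boundaryIncl d).continuous.continuousAt, ?_⟩ :
    Filter.Tendsto (boundaryIncl d) (𝓝 y) (𝓝[range (𝓡∂ (d + 1))] (boundaryIncl d y))) h1
  exact Filter.Eventually.of_forall fun z => mem_range_halfSpace.2 (by simp)

omit h in
lemma symm_mem_boundary {p : M} {y : EuclideanSpace ℝ (Fin d)} (hy : y ∈ boundaryDomain d p) :
    (extChartAt (𝓡∂ (d + 1)) p).symm (boundaryIncl d y) ∈ (𝓡∂ (d + 1)).boundary M := by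
  refine (mem_boundary_iff_of_mem_source ((extChartAt _ p).map_target hy)).2 ?_
  rw [PartialEquiv.right_inv _ hy, boundaryIncl_zero]

omit h in
lemma boundaryCoord_mem {p : M} (hp : p ∈ (𝓡∂ (d + 1)).boundary M) :
    boundaryCoord d p ∈ boundaryDomain d p := by
  rw [boundaryDomain, mem_preimage, boundaryIncl_boundaryCoord ((mem_boundary_iff p).1 hp)]
  exact mem_extChartAt_target p

omit [IsManifold (𝓡∂ (d + 1)) 1 M] h in
lemma boundaryRep_apply (f : M → ℝ) (p : M) (y : EuclideanSpace ℝ (Fin d)) :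
    boundaryRep f p y = f ((extChartAt (𝓡∂ (d + 1)) p).symm (boundaryIncl d y)) := rfl

/-- The left side uses a different chart at each point, so its smoothness is not visible; chart
invariance replaces it by an expression in the single chart at `p`. -/
lemma boundaryRep_normSq_eq (hm : 1 ≤ m) (g : RiemMetric m d M) (p : M)
    {y : EuclideanSpace ℝ (Fin d)} (hy : y ∈ boundaryDomain d p) :
    boundaryRep (normSqSecondFundamentalForm g) p y = normSqAt g p (boundaryIncl d y) := by
  rw [boundaryRep_apply, normSq_eq_of_mem_source hm g ((extChartAt _ p).map_target hy)
    (symm_mem_boundary hy), PartialEquiv.right_inv _ hy]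

lemma contDiffOn_boundaryRep_normSq (hn : n + 1 ≤ m) (g : RiemMetric m d M) (p : M) :
    ContDiffOn ℝ n (boundaryRep (normSqSecondFundamentalForm g) p) (boundaryDomain d p) :=
  ((contDiffOn_normSqAt hn g p).comp (boundaryIncl d).contDiff.contDiffOn fun _ hy => hy).congr
    fun _ hy => boundaryRep_normSq_eq ((Nat.le_add_left 1 n).trans hn) g p hy

end Smoothness

/-! ### Non-degenerate critical points -/

section Nondegenerate

variable {E F : Type*} [NormedAddCommGroup E] [NormedSpace ℝ E]
  [NormedAddCommGroup F] [NormedSpace ℝ F]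

/-- If `y` is a critical point of `f`, then the Hessian of `f` at `y` is non-degenerate. -/
def NondegenerateAt (f : E → ℝ) (y : E) : Prop :=
  fderiv ℝ f y = 0 → ∀ v, (∀ w, fderiv ℝ (fderiv ℝ f) y v w = 0) → v = 0

lemma NondegenerateAt.congr {f f' : E → ℝ} {y : E} (h : NondegenerateAt f y) (hf : f' =ᶠ[𝓝 y] f) :
    NondegenerateAt f' y := by
  unfold NondegenerateAt
  rw [hf.fderiv_eq, hf.fderiv.fderiv_eq]
  exact h

/-- Where `η` vanishes, the derivative of `c • η` is `c • Dη`; a non-zero factor in the differential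
can therefore be dropped. -/
lemma nondegenerateAt_iff_of_fderiv_eq_smul {f c : E → ℝ} {η : E → E →L[ℝ] ℝ} {y : E}
    (hf : ∀ᶠ z in 𝓝 y, fderiv ℝ f z = c z • η z) (hc : DifferentiableAt ℝ c y)
    (hη : DifferentiableAt ℝ η y) (h0 : c y ≠ 0) :
    NondegenerateAt f y ↔ (η y = 0 → ∀ v, (∀ w, fderiv ℝ η y v w = 0) → v = 0) := by
  have h1 : fderiv ℝ f y = 0 ↔ η y = 0 := by
    rw [hf.self_of_nhds, smul_eq_zero, or_iff_right h0]
  unfold NondegenerateAt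
  rw [h1]
  refine imp_congr_right fun hηy => forall_congr' fun v => ?_
  have h2 : fderiv ℝ (fderiv ℝ f) y = c y • fderiv ℝ η y := by
    rw [Filter.EventuallyEq.fderiv_eq (show fderiv ℝ f =ᶠ[𝓝 y] fun z => c z • η z from hf),
      fderiv_fun_smul hc hη, hηy]
    ext v w
    simp
  rw [h2]
  simp [h0]

set_option synthInstance.maxHeartbeats 200000 in
-- At a critical point the term with the second derivative of `ψ` disappears, so the Hessian
-- transforms as a bilinear form.
lemma NondegenerateAt.comp {f : F → ℝ} {ψ : E → F} {y : E} {h : E → ℝ}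
    (hf : NondegenerateAt f (ψ y)) (hf2 : ContDiffAt ℝ 2 f (ψ y)) (hψ : ContDiffAt ℝ 2 ψ y)
    (hbij : Function.Bijective (fderiv ℝ ψ y)) (hh : h =ᶠ[𝓝 y] f ∘ ψ) :
    NondegenerateAt h y := by
  refine NondegenerateAt.congr ?_ hh
  have hfd : ∀ᶠ z in 𝓝 y, fderiv ℝ (f ∘ ψ) z = (fderiv ℝ f (ψ z)).comp (fderiv ℝ ψ z) := by
    have h1 := hψ.eventually (by simp)
    have h2 := hψ.continuousAt.eventually (hf2.eventually (by simp))
    filter_upwards [h1, h2] with z hz1 hz2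
    exact fderiv_comp z (hz2.differentiableAt (by simp)) (hz1.differentiableAt (by simp))
  intro hcrit v hv
  have hcf : fderiv ℝ f (ψ y) = 0 := by
    rw [hfd.self_of_nhds] at hcrit
    ext w
    obtain ⟨w, rfl⟩ := hbij.2 w
    exact DFunLike.congr_fun hcrit w
  have hdf : DifferentiableAt ℝ (fderiv ℝ f) (ψ y) :=
    (hf2.fderiv_right (m := 1) (by norm_num)).differentiableAt one_ne_zero
  have hdψ : DifferentiableAt ℝ (fderiv ℝ ψ) y :=
    (hψ.fderiv_right (m := 1) (by norm_num)).differentiableAt one_ne_zero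
  have hψd := hψ.differentiableAt (by simp)
  have h2 : ∀ w, fderiv ℝ (fderiv ℝ (f ∘ ψ)) y v w =
      fderiv ℝ (fderiv ℝ f) (ψ y) (fderiv ℝ ψ y v) (fderiv ℝ ψ y w) := by
    intro w
    have h3 := (HasFDerivAt.comp y hdf.hasFDerivAt hψd.hasFDerivAt).clm_comp hdψ.hasFDerivAt
    have h4 := h3.congr_of_eventuallyEq hfd
    rw [h4.fderiv]
    simp [hcf]
  refine hbij.1 ?_
  rw [map_zero]
  refine hf hcf _ fun w => ?_
  obtain ⟨w, rfl⟩ := hbij.2 w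
  rw [← h2, hv]

/-- Equidimensional Sard for the gradient of `L`: the set where a differentiable map of ℝᵈ to itself
has singular derivative has null image. -/
lemma ae_nondegenerateAt_sub_linear {d : ℕ} {L : EuclideanSpace ℝ (Fin d) → ℝ}
    {V : Set (EuclideanSpace ℝ (Fin d))} (hV : IsOpen V) (hL : ContDiffOn ℝ 2 L V) :
    MeasureTheory.volume {t : EuclideanSpace ℝ (Fin d) |
      ∃ y ∈ V, fderiv ℝ L y = innerSL ℝ t ∧
        ∃ v ≠ 0, ∀ w, fderiv ℝ (fderiv ℝ L) y v w = 0} = 0 := by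
  let T : (EuclideanSpace ℝ (Fin d) →L[ℝ] ℝ) →L[ℝ] EuclideanSpace ℝ (Fin d) :=
    LinearMap.toContinuousLinearMap
      { toFun := fun l => WithLp.toLp 2 fun i => l (EuclideanSpace.single i 1)
        map_add' := fun _ _ => rfl
        map_smul' := fun _ _ => rfl }
  let S : Set (EuclideanSpace ℝ (Fin d)) := {y ∈ V | ∃ v ≠ 0, ∀ w, fderiv ℝ (fderiv ℝ L) y v w = 0}
  have hd : ∀ y ∈ S, HasFDerivWithinAt (fun z => T (fderiv ℝ L z))
      (T.comp (fderiv ℝ (fderiv ℝ L) y)) S y := by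
    intro y hy
    have h1 : DifferentiableAt ℝ (fderiv ℝ L) y :=
      (((hL.contDiffAt (hV.mem_nhds hy.1)).fderiv_right (m := 1)
        (by norm_num)).differentiableAt one_ne_zero)
    exact (T.hasFDerivAt.comp y h1.hasFDerivAt).hasFDerivWithinAt
  have h0 := MeasureTheory.addHaar_image_eq_zero_of_det_fderivWithin_eq_zero
    MeasureTheory.volume hd ?_
  · refine MeasureTheory.measure_mono_null ?_ h0
    rintro t ⟨y, hy, ht, hv⟩
    refine ⟨y, ⟨hy, hv⟩, ?_⟩
    change T (fderiv ℝ L y) = t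
    rw [ht]
    ext i
    change innerSL ℝ t (EuclideanSpace.single i 1) = t i
    simp [EuclideanSpace.inner_single_right]
  · rintro y ⟨hy, v, hv, h⟩
    have h2 : fderiv ℝ (fderiv ℝ L) y v = 0 := by ext w; exact h w
    refine LinearMap.det_eq_zero_iff_ker_ne_bot.2 fun hk => hv (LinearMap.ker_eq_bot'.1 hk v ?_)
    change T (fderiv ℝ (fderiv ℝ L) y v) = 0
    rw [h2, map_zero]

end Nondegenerate

/-! ### Parametric derivatives -/

section Parametric

/-- Induction on `k`: the derivative in the second variable is again jointly smooth, of one order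
less. The target `F` varies in the induction because it becomes a space of linear maps. -/
lemma continuousOn_iteratedFDerivWithin_param {P E : Type} [NormedAddCommGroup P]
    [NormedSpace ℝ P] [NormedAddCommGroup E] [NormedSpace ℝ E] {s : Set E}
    (hs : UniqueDiffOn ℝ s) (k : ℕ) {F : Type} [NormedAddCommGroup F] [NormedSpace ℝ F]
    {H : P → E → F} (hH : ContDiffOn ℝ k (Function.uncurry H) (univ ×ˢ s)) :
    ContinuousOn (fun z : P × E => iteratedFDerivWithin ℝ k (H z.1) s z.2) (univ ×ˢ s) := by
  induction k generalizing F with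
  | zero =>
    simp only [iteratedFDerivWithin_zero_eq_comp]
    exact (LinearIsometryEquiv.continuous _).comp_continuousOn hH.continuousOn
  | succ k ih =>
    have h1 : ContDiffOn ℝ k (Function.uncurry fun t y => fderivWithin ℝ (H t) s y)
        (univ ×ˢ s) := by
      rintro ⟨t, y⟩ hz
      refine ContDiffWithinAt.fderivWithin (f := fun z : P × E => H z.1) (g := Prod.snd)
        (n := ((k + 1 : ℕ) : WithTop ℕ∞)) ?_ contDiffWithinAt_snd hs (by simp) hz
        (fun z hz => hz.2)
      refine ContDiffWithinAt.comp (g := Function.uncurry H)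
        (f := fun w : (P × E) × E => (w.1.1, w.2)) (t := univ ×ˢ s) ((t, y), y) (hH _ hz)
        (by fun_prop) fun w hw => ⟨mem_univ _, hw.2⟩
    have h2 := ih h1
    refine ((continuousMultilinearCurryRightEquiv' ℝ k E F).symm.continuous.comp_continuousOn
      h2).congr fun z hz => ?_
    rw [iteratedFDerivWithin_succ_eq_comp_right hs hz.2]
    rfl

end Parametric

/-! ### Openness -/

section Openness

variable {m d : ℕ} {M : Type*} [TopologicalSpace M]
  [ChartedSpace (EuclideanHalfSpace (d + 1)) M] [IsManifold (𝓡∂ (d + 1)) 1 M]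

lemma continuous_jet (p : M) (i j : Fin (d + 1)) {k : ℕ} (hk : k ≤ m) :
    Continuous fun g : RiemMetric m d M => UniformOnFun.ofFun
      {K | IsCompact K ∧ K ⊆ (extChartAt (𝓡∂ (d + 1)) p).target}
      (iteratedFDerivWithin ℝ k (metricComp g p i j) (extChartAt (𝓡∂ (d + 1)) p).target) := by
  refine continuous_iInf_dom (i := p) (continuous_iInf_dom (i := i) (continuous_iInf_dom (i := j)
    (continuous_iInf_dom (i := ⟨k, Nat.lt_succ_of_le hk⟩) continuous_induced_dom)))

omit [IsManifold (𝓡∂ (d + 1)) 1 M] in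
lemma exists_closedBall_inter_subset_target {p : M} {y : EuclideanSpace ℝ (Fin (d + 1))}
    (hy : y ∈ (extChartAt (𝓡∂ (d + 1)) p).target) :
    ∃ r > 0, Metric.closedBall y r ∩ range (𝓡∂ (d + 1)) ⊆ (extChartAt (𝓡∂ (d + 1)) p).target := by
  obtain ⟨ε, hε, h⟩ := Metric.mem_nhdsWithin_iff.1
    (extChartAt_target_mem_nhdsWithin_of_mem (I := 𝓡∂ (d + 1)) hy)
  exact ⟨ε / 2, by positivity, (inter_subset_inter_left _
    (Metric.closedBall_subset_ball (by linarith))).trans h⟩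

/-- Convergence of metrics is uniform on a compact neighbourhood of `y` in the chart target; with
continuity in the point for a fixed metric, this gives joint continuity. -/
lemma continuousOn_jet [h : IsManifold (𝓡∂ (d + 1)) ((m + 1 : ℕ) : WithTop ℕ∞) M]
    (p : M) (i j : Fin (d + 1)) {k : ℕ} (hk : k ≤ m) :
    ContinuousOn (fun z : RiemMetric m d M × EuclideanSpace ℝ (Fin (d + 1)) =>
      iteratedFDerivWithin ℝ k (metricComp z.1 p i j) (extChartAt (𝓡∂ (d + 1)) p).target z.2)
      (univ ×ˢ (extChartAt (𝓡∂ (d + 1)) p).target) := by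
  rintro ⟨g, y⟩ ⟨-, hy⟩
  obtain ⟨r, hr, hrt⟩ := exists_closedBall_inter_subset_target hy
  set K := Metric.closedBall y r ∩ range (𝓡∂ (d + 1))
  have hK : IsCompact K := (isCompact_closedBall y r).inter_right (𝓡∂ (d + 1)).isClosed_range
  have hKn : K ∈ 𝓝[(extChartAt (𝓡∂ (d + 1)) p).target] y :=
    Filter.inter_mem (mem_nhdsWithin_of_mem_nhds (Metric.closedBall_mem_nhds y hr))
      (Filter.mem_of_superset self_mem_nhdsWithin (extChartAt_target_subset_range p))
  have h1 := UniformOnFun.tendsto_iff_tendstoUniformlyOn.1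
    ((continuous_jet (M := M) p i j hk).tendsto g) K ⟨hK, hrt⟩
  have h2 : ContinuousOn (iteratedFDerivWithin ℝ k (metricComp g p i j)
      (extChartAt (𝓡∂ (d + 1)) p).target) (extChartAt (𝓡∂ (d + 1)) p).target :=
    (contDiffOn_metricComp g p i j).continuousOn_iteratedFDerivWithin (by exact_mod_cast hk)
      (uniqueDiffOn_extChartAt_target p)
  have h3 := h2 y hy
  rw [ContinuousWithinAt, nhdsWithin_prod_eq, nhdsWithin_univ, Metric.tendsto_nhds]
  intro ε hε
  have h4 := (Metric.tendstoUniformlyOn_iff.1 h1) (ε / 2) (by positivity)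
  have h5 := (Metric.tendsto_nhds.1 h3) (ε / 2) (by positivity)
  filter_upwards [h4.prod_mk (h5.and hKn)] with z hz
  obtain ⟨hz1, hz2, hz3⟩ := hz
  have h6 := hz1 z.2 hz3
  rw [dist_comm] at h6
  exact (dist_triangle _ _ _).trans_lt (by
    have := add_lt_add h6 hz2
    rwa [add_halves] at this)

/-- A metric component in the boundary coordinates given by the preferred chart at `p`. -/
def boundaryComp (g : RiemMetric m d M) (p : M) (y : EuclideanSpace ℝ (Fin d)) : ℝ :=
  metricComp g p 0 0 (boundaryIncl d y)

/-- Being positive and scaling by e^{2u}, the component g₀₀ records the conformal factor and may be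
divided by. -/
lemma boundaryComp_pos (g : RiemMetric m d M) {p : M} {y : EuclideanSpace ℝ (Fin d)}
    (hy : y ∈ boundaryDomain d p) : 0 < boundaryComp g p y := by
  rw [boundaryComp, ← chartForm_coordVec]
  exact chartForm_pos g p hy (by simp [coordVec])

variable [h : IsManifold (𝓡∂ (d + 1)) ((m + 1 : ℕ) : WithTop ℕ∞) M]

lemma contDiffOn_boundaryComp (g : RiemMetric m d M) (p : M) :
    ContDiffOn ℝ m (boundaryComp g p) (boundaryDomain d p) :=
  (contDiffOn_metricComp g p 0 0).comp (boundaryIncl d).contDiff.contDiffOn fun _ hy => hy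

lemma iteratedFDeriv_boundaryComp (g : RiemMetric m d M) {p : M} {k : ℕ} (hk : k ≤ m)
    {y : EuclideanSpace ℝ (Fin d)} (hy : y ∈ boundaryDomain d p) :
    iteratedFDeriv ℝ k (boundaryComp g p) y =
      (iteratedFDerivWithin ℝ k (metricComp g p 0 0) (extChartAt (𝓡∂ (d + 1)) p).target
        (boundaryIncl d y)).compContinuousLinearMap fun _ => boundaryIncl d := by
  rw [← iteratedFDerivWithin_of_isOpen k (isOpen_boundaryDomain p) hy]
  exact (boundaryIncl d).iteratedFDerivWithin_comp_right (contDiffOn_metricComp g p 0 0)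
    (uniqueDiffOn_extChartAt_target p) (isOpen_boundaryDomain p).uniqueDiffOn hy
    (by exact_mod_cast hk)

lemma continuousOn_iteratedFDeriv_boundaryComp (p : M) {k : ℕ} (hk : k ≤ m)
    (v : Fin k → EuclideanSpace ℝ (Fin d)) :
    ContinuousOn (fun z : RiemMetric m d M × EuclideanSpace ℝ (Fin d) =>
      iteratedFDeriv ℝ k (boundaryComp z.1 p) z.2 v) (univ ×ˢ boundaryDomain d p) := by
  have h1 : ContinuousOn (fun z : RiemMetric m d M × EuclideanSpace ℝ (Fin d) =>
      iteratedFDerivWithin ℝ k (metricComp z.1 p 0 0) (extChartAt (𝓡∂ (d + 1)) p).target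
        (boundaryIncl d z.2)) (univ ×ˢ boundaryDomain d p) :=
    (continuousOn_jet p 0 0 hk).comp (f := fun z : RiemMetric m d M × EuclideanSpace ℝ (Fin d) =>
      (z.1, boundaryIncl d z.2)) (by fun_prop) fun z hz => ⟨mem_univ _, hz.2⟩
  have h2 := (ContinuousMultilinearMap.apply ℝ
    (fun _ : Fin k => EuclideanSpace ℝ (Fin (d + 1))) ℝ
    fun i => boundaryIncl d (v i)).continuous.comp_continuousOn h1
  refine h2.congr fun z hz => ?_
  rw [iteratedFDeriv_boundaryComp z.1 hk hz.2]
  rfl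

lemma continuousOn_boundaryComp (p : M) :
    ContinuousOn (fun z : RiemMetric m d M × EuclideanSpace ℝ (Fin d) =>
      boundaryComp z.1 p z.2) (univ ×ˢ boundaryDomain d p) := by
  simpa using continuousOn_iteratedFDeriv_boundaryComp (m := m) p (Nat.zero_le m) 0

lemma continuousOn_fderiv_boundaryComp (hm : 1 ≤ m) (p : M) (v : EuclideanSpace ℝ (Fin d)) :
    ContinuousOn (fun z : RiemMetric m d M × EuclideanSpace ℝ (Fin d) =>
      fderiv ℝ (boundaryComp z.1 p) z.2 v) (univ ×ˢ boundaryDomain d p) := by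
  simpa using continuousOn_iteratedFDeriv_boundaryComp (m := m) p hm fun _ => v

lemma continuousOn_fderiv_fderiv_boundaryComp (hm : 2 ≤ m) (p : M)
    (v w : EuclideanSpace ℝ (Fin d)) :
    ContinuousOn (fun z : RiemMetric m d M × EuclideanSpace ℝ (Fin d) =>
      fderiv ℝ (fderiv ℝ (boundaryComp z.1 p)) z.2 v w) (univ ×ˢ boundaryDomain d p) := by
  simpa [iteratedFDeriv_two_apply] using
    continuousOn_iteratedFDeriv_boundaryComp (m := m) p hm ![v, w]

variable {g : RiemMetric m d M}

omit h in
lemma boundaryComp_conformalMetric (u : C^m⟮𝓡∂ (d + 1), M; 𝓘(ℝ, ℝ), ℝ⟯) (p : M)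
    (y : EuclideanSpace ℝ (Fin d)) : boundaryComp (conformalMetric g u) p y =
      Real.exp (2 * u ((extChartAt (𝓡∂ (d + 1)) p).symm (boundaryIncl d y))) *
        boundaryComp g p y :=
  metricComp_conformalMetric g u p 0 0 _

lemma boundaryRep_normSq_conformalMetric (hm : 1 ≤ m) (u : C^m⟮𝓡∂ (d + 1), M; 𝓘(ℝ, ℝ), ℝ⟯)
    (hu : ∀ p ∈ (𝓡∂ (d + 1)).boundary M, normalDeriv g u p = 0) {p : M}
    {y : EuclideanSpace ℝ (Fin d)} (hy : y ∈ boundaryDomain d p) :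
    boundaryRep (normSqSecondFundamentalForm (conformalMetric g u)) p y =
      Real.exp (-2 * u ((extChartAt (𝓡∂ (d + 1)) p).symm (boundaryIncl d y))) *
        boundaryRep (normSqSecondFundamentalForm g) p y :=
  normSq_conformalMetric g u _ hm (hu _ (symm_mem_boundary hy))

/-- The logarithm of a conformally invariant function: for a metric `g'` in the minimal conformal
class of `g`, `‖𝕀‖²` is the exponential of this function divided by a component of `g'`. -/
def logInvariant (g : RiemMetric m d M) (p : M) (y : EuclideanSpace ℝ (Fin d)) : ℝ :=
  Real.log (boundaryRep (normSqSecondFundamentalForm g) p y * boundaryComp g p y)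

lemma boundaryRep_normSq_pos (hm : 1 ≤ m)
    (hII : ∀ p ∈ (𝓡∂ (d + 1)).boundary M, secondFundamentalForm g p ≠ 0) {p : M}
    {y : EuclideanSpace ℝ (Fin d)} (hy : y ∈ boundaryDomain d p) :
    0 < boundaryRep (normSqSecondFundamentalForm g) p y :=
  normSq_pos hm g (hII _ (symm_mem_boundary hy))

/-- The factors e^{-2u} and e^{2u} cancel in the product of ‖𝕀‖² and g₀₀. The dependence on `g'`
thus reduces to one metric component, with no derivative of it. -/
lemma boundaryRep_normSq_eq_exp_div (hm : 1 ≤ m) (hd : d ≠ 0) (hH : HasMinimalBoundary g)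
    (hII : ∀ p ∈ (𝓡∂ (d + 1)).boundary M, secondFundamentalForm g p ≠ 0)
    {g' : RiemMetric m d M} (hg' : g' ∈ minimalConformalClass g) {p : M}
    {y : EuclideanSpace ℝ (Fin d)} (hy : y ∈ boundaryDomain d p) :
    boundaryRep (normSqSecondFundamentalForm g') p y =
      Real.exp (logInvariant g p y) / boundaryComp g' p y := by
  obtain ⟨u, hu, rfl⟩ := (mem_minimalConformalClass_iff g hm hd hH g').1 hg'
  have h1 := boundaryRep_normSq_pos hm hII hy
  have h2 := boundaryComp_pos g hy
  rw [boundaryRep_normSq_conformalMetric hm u hu hy, boundaryComp_conformalMetric, logInvariant,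
    Real.exp_log (mul_pos h1 h2), neg_mul, Real.exp_neg]
  field_simp

lemma contDiffOn_logInvariant (hm : 3 ≤ m)
    (hII : ∀ p ∈ (𝓡∂ (d + 1)).boundary M, secondFundamentalForm g p ≠ 0) (p : M) :
    ContDiffOn ℝ 2 (logInvariant g p) (boundaryDomain d p) := by
  refine ContDiffOn.log ?_ fun y hy =>
    (mul_pos (boundaryRep_normSq_pos (by omega) hII hy) (boundaryComp_pos g hy)).ne'
  refine ContDiffOn.mul ?_ ?_
  · exact_mod_cast contDiffOn_boundaryRep_normSq (n := 2) hm g p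
  · exact (contDiffOn_boundaryComp g p).of_le (by exact_mod_cast (by omega : 2 ≤ m))

/-- A sum of squares that vanishes for some unit vector `v` exactly when `y` is a degenerate critical
point of the squared norm of the second fundamental form of `g'`. -/
def degeneracy (g g' : RiemMetric m d M) (p : M) (y v : EuclideanSpace ℝ (Fin d)) : ℝ :=
  ∑ j, (boundaryComp g' p y * fderiv ℝ (logInvariant g p) y (EuclideanSpace.single j 1) -
      fderiv ℝ (boundaryComp g' p) y (EuclideanSpace.single j 1)) ^ 2 +
    ∑ j, (∑ i, v i * (fderiv ℝ (boundaryComp g' p) y (EuclideanSpace.single i 1) *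
        fderiv ℝ (logInvariant g p) y (EuclideanSpace.single j 1) +
      boundaryComp g' p y * fderiv ℝ (fderiv ℝ (logInvariant g p)) y (EuclideanSpace.single i 1)
        (EuclideanSpace.single j 1) -
      fderiv ℝ (fderiv ℝ (boundaryComp g' p)) y (EuclideanSpace.single i 1)
        (EuclideanSpace.single j 1))) ^ 2

omit h in
lemma continuousLinearMap_eq_zero_iff {F : Type*} [NormedAddCommGroup F] [NormedSpace ℝ F]
    (l : EuclideanSpace ℝ (Fin d) →L[ℝ] F) :
    l = 0 ↔ ∀ j, l (EuclideanSpace.single j 1) = 0 := by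
  refine ⟨fun hl j => by simp [hl], fun hl => ?_⟩
  ext v
  have : v = ∑ i, v i • EuclideanSpace.single i (1 : ℝ) := by
    ext j; simp [Pi.single_apply]
  rw [this, map_sum]
  simp [hl]

/-- With a = `logInvariant` and G the component g₀₀ of `g'`, the differential of e^a/G is (e^a/G²)(G
da − dG), and the positive factor is dropped. Restricting to unit vectors makes the set of test
vectors compact. -/
lemma nondegenerateAt_iff_degeneracy_ne_zero (hm : 3 ≤ m) (hd : d ≠ 0) (hH : HasMinimalBoundary g)
    (hII : ∀ p ∈ (𝓡∂ (d + 1)).boundary M, secondFundamentalForm g p ≠ 0)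
    {g' : RiemMetric m d M} (hg' : g' ∈ minimalConformalClass g) {p : M}
    {y : EuclideanSpace ℝ (Fin d)} (hy : y ∈ boundaryDomain d p) :
    NondegenerateAt (boundaryRep (normSqSecondFundamentalForm g') p) y ↔
      ∀ v ∈ Metric.sphere (0 : EuclideanSpace ℝ (Fin d)) 1, degeneracy g g' p y v ≠ 0 := by
  have hV := isOpen_boundaryDomain (d := d) p
  have hG : ContDiffOn ℝ 2 (boundaryComp g' p) (boundaryDomain d p) :=
    (contDiffOn_boundaryComp g' p).of_le (by exact_mod_cast (by omega : 2 ≤ m))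
  have ha := contDiffOn_logInvariant hm hII p
  have hGd : ∀ z ∈ boundaryDomain d p, DifferentiableAt ℝ (boundaryComp g' p) z := fun z hz =>
    (hG.contDiffAt (hV.mem_nhds hz)).differentiableAt (by simp)
  have had : ∀ z ∈ boundaryDomain d p, DifferentiableAt ℝ (logInvariant g p) z := fun z hz =>
    (ha.contDiffAt (hV.mem_nhds hz)).differentiableAt (by simp)
  have hGd2 : DifferentiableAt ℝ (fderiv ℝ (boundaryComp g' p)) y :=
    ((hG.contDiffAt (hV.mem_nhds hy)).fderiv_right (m := 1) (by norm_num)).differentiableAt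
      one_ne_zero
  have had2 : DifferentiableAt ℝ (fderiv ℝ (logInvariant g p)) y :=
    ((ha.contDiffAt (hV.mem_nhds hy)).fderiv_right (m := 1) (by norm_num)).differentiableAt
      one_ne_zero
  set G := boundaryComp g' p
  set a := logInvariant g p
  set f := boundaryRep (d := d) (normSqSecondFundamentalForm g') p
  have hf : ∀ z ∈ boundaryDomain d p, f z = Real.exp (a z) / G z := fun z hz =>
    boundaryRep_normSq_eq_exp_div (by omega) hd hH hII hg' hz
  have hGpos : ∀ z ∈ boundaryDomain d p, 0 < G z := fun z hz => boundaryComp_pos g' hz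
  have hfd : ∀ᶠ z in 𝓝 y, fderiv ℝ f z =
      (Real.exp (a z) / G z ^ 2) • (G z • fderiv ℝ a z - fderiv ℝ G z) := by
    filter_upwards [hV.mem_nhds hy] with z hz
    have h1 : f =ᶠ[𝓝 z] fun z => Real.exp (a z) / G z := by
      filter_upwards [hV.mem_nhds hz] with w hw using hf w hw
    have h2 := ((had z hz).hasFDerivAt.exp.mul
      ((hasDerivAt_inv (hGpos z hz).ne').comp_hasFDerivAt z (hGd z hz).hasFDerivAt))
    have h3 := h2.congr_of_eventuallyEq (h1.trans (Filter.Eventually.of_forall fun w => by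
      simp [div_eq_mul_inv]))
    rw [h3.fderiv]
    ext w
    have := (hGpos z hz).ne'
    simp
    field_simp
    ring
  have hcd : DifferentiableAt ℝ (fun z => Real.exp (a z) / G z ^ 2) y :=
    ((had y hy).exp.mul (((hGd y hy).fun_pow 2).inv (pow_pos (hGpos y hy) 2).ne'))
  rw [nondegenerateAt_iff_of_fderiv_eq_smul hfd hcd (((hGd y hy).fun_smul had2).fun_sub hGd2)
    (div_pos (Real.exp_pos _) (pow_pos (hGpos y hy) 2)).ne']
  have hη : ∀ v w, fderiv ℝ (fun z => G z • fderiv ℝ a z - fderiv ℝ G z) y v w =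
      fderiv ℝ G y v * fderiv ℝ a y w + G y * fderiv ℝ (fderiv ℝ a) y v w -
        fderiv ℝ (fderiv ℝ G) y v w := by
    intro v w
    rw [(((hGd y hy).hasFDerivAt.fun_smul had2.hasFDerivAt).fun_sub hGd2.hasFDerivAt).fderiv]
    simp
    ring
  have hdeg : ∀ v, degeneracy g g' p y v =
      ∑ j, ((G y • fderiv ℝ a y - fderiv ℝ G y) (EuclideanSpace.single j 1)) ^ 2 +
      ∑ j, (fderiv ℝ (fun z => G z • fderiv ℝ a z - fderiv ℝ G z) y v
        (EuclideanSpace.single j 1)) ^ 2 := by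
    intro v
    rw [degeneracy]
    congr 1
    refine Finset.sum_congr rfl fun j _ => ?_
    have hv : v = ∑ i, v i • EuclideanSpace.single i (1 : ℝ) := by
      ext j; simp [Pi.single_apply]
    conv_rhs => rw [hv]
    simp only [map_sum, map_smul, sum_apply, smul_apply, smul_eq_mul, hη]
    rfl
  constructor
  · intro hnd v hv h0
    rw [hdeg] at h0
    have h1 := (add_eq_zero_iff_of_nonneg (Finset.sum_nonneg fun _ _ => sq_nonneg _)
      (Finset.sum_nonneg fun _ _ => sq_nonneg _)).1 h0
    have h2 := (Finset.sum_eq_zero_iff_of_nonneg fun _ _ => sq_nonneg _).1 h1.1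
    have h3 := (Finset.sum_eq_zero_iff_of_nonneg fun _ _ => sq_nonneg _).1 h1.2
    have h4 := (continuousLinearMap_eq_zero_iff (G y • fderiv ℝ a y - fderiv ℝ G y)).2
      fun j => by simpa only [sq_eq_zero_iff] using h2 j (Finset.mem_univ j)
    have h5 := (continuousLinearMap_eq_zero_iff
      (fderiv ℝ (fun z => G z • fderiv ℝ a z - fderiv ℝ G z) y v)).2
      fun j => by simpa only [sq_eq_zero_iff] using h3 j (Finset.mem_univ j)
    have h6 := hnd h4 v fun w => by rw [h5, zero_apply]
    simp [h6] at hv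
  · intro hs hη0 v hv
    by_contra hv0
    refine hs (‖v‖⁻¹ • v) (by simp [norm_smul, hv0]) ?_
    rw [hdeg, hη0]
    simp [hv]

lemma isOpen_nondegenerate (hm : 3 ≤ m) (hd : d ≠ 0) (hH : HasMinimalBoundary g)
    (hII : ∀ p ∈ (𝓡∂ (d + 1)).boundary M, secondFundamentalForm g p ≠ 0) (p : M)
    {K : Set (EuclideanSpace ℝ (Fin d))} (hK : IsCompact K) (hKp : K ⊆ boundaryDomain d p) :
    IsOpen {g' : minimalConformalClass g | ∀ y ∈ K, NondegenerateAt
      (boundaryRep (normSqSecondFundamentalForm (g' : RiemMetric m d M)) p) y} := by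
  have hset : {g' : minimalConformalClass g | ∀ y ∈ K, NondegenerateAt
      (boundaryRep (normSqSecondFundamentalForm (g' : RiemMetric m d M)) p) y} =
      {g' : minimalConformalClass g |
        ∀ z ∈ K ×ˢ Metric.sphere (0 : EuclideanSpace ℝ (Fin d)) 1,
          degeneracy g g' p z.1 z.2 ≠ 0} := by
    ext g'
    exact ⟨fun h z hz => (nondegenerateAt_iff_degeneracy_ne_zero hm hd hH hII g'.2
      (hKp hz.1)).1 (h z.1 hz.1) z.2 hz.2, fun h y hy =>
      (nondegenerateAt_iff_degeneracy_ne_zero hm hd hH hII g'.2 (hKp hy)).2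
        fun v hv => h (y, v) ⟨hy, hv⟩⟩
  have hV := isOpen_boundaryDomain (d := d) p
  have hcont : ContinuousOn (fun z : RiemMetric m d M ×
      (EuclideanSpace ℝ (Fin d) × EuclideanSpace ℝ (Fin d)) => degeneracy g z.1 p z.2.1 z.2.2)
      (univ ×ˢ (boundaryDomain d p ×ˢ univ)) := by
    have ha := contDiffOn_logInvariant hm hII p
    have ha1 : ContinuousOn (fderiv ℝ (logInvariant g p)) (boundaryDomain d p) :=
      ha.continuousOn_fderiv_of_isOpen hV (by simp)
    have ha2 : ContinuousOn (fderiv ℝ (fderiv ℝ (logInvariant g p))) (boundaryDomain d p) :=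
      (ha.fderiv_of_isOpen hV (m := 1) (by norm_num)).continuousOn_fderiv_of_isOpen hV le_rfl
    let S : Set (RiemMetric m d M × (EuclideanSpace ℝ (Fin d) × EuclideanSpace ℝ (Fin d))) :=
      univ ×ˢ (boundaryDomain d p ×ˢ univ)
    have hπ : ContinuousOn (fun z : RiemMetric m d M ×
        (EuclideanSpace ℝ (Fin d) × EuclideanSpace ℝ (Fin d)) => (z.1, z.2.1)) S := by fun_prop
    have hπm : MapsTo (fun z : RiemMetric m d M ×
        (EuclideanSpace ℝ (Fin d) × EuclideanSpace ℝ (Fin d)) => (z.1, z.2.1)) S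
        (univ ×ˢ boundaryDomain d p) := fun z hz => ⟨mem_univ _, hz.2.1⟩
    have hσ : ContinuousOn (fun z : RiemMetric m d M ×
        (EuclideanSpace ℝ (Fin d) × EuclideanSpace ℝ (Fin d)) => z.2.1) S := by fun_prop
    have hσm : MapsTo (fun z : RiemMetric m d M ×
        (EuclideanSpace ℝ (Fin d) × EuclideanSpace ℝ (Fin d)) => z.2.1) S
        (boundaryDomain d p) := fun z hz => hz.2.1
    have c0 := (continuousOn_boundaryComp (m := m) p).comp hπ hπm
    have c1 := fun v => (continuousOn_fderiv_boundaryComp (m := m) (by omega) p v).comp hπ hπm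
    have c2 := fun v w =>
      (continuousOn_fderiv_fderiv_boundaryComp (m := m) (by omega) p v w).comp hπ hπm
    have a1 := fun v => (ha1.comp hσ hσm).clm_apply (continuousOn_const (c := v))
    have a2 := fun v w => ((ha2.comp hσ hσm).clm_apply
      (continuousOn_const (c := v))).clm_apply (continuousOn_const (c := w))
    have hv : ∀ i, ContinuousOn (fun z : RiemMetric m d M ×
        (EuclideanSpace ℝ (Fin d) × EuclideanSpace ℝ (Fin d)) => z.2.2 i) S := by fun_prop
    unfold degeneracy
    refine (continuousOn_finsetSum _ fun j _ => ((c0.mul (a1 _)).sub (c1 _)).pow 2).add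
      (continuousOn_finsetSum _ fun j _ => (continuousOn_finsetSum _ fun i _ =>
        (hv i).mul ((((c1 _).mul (a1 _)).add (c0.mul (a2 _ _))).sub (c2 _ _))).pow 2)
  rw [hset, isOpen_iff_mem_nhds]
  intro g' hg'
  -- Tube lemma: non-vanishing near each point of the compact set holds uniformly for all metrics
  -- near `g'`.
  refine (hK.prod (isCompact_sphere 0 1)).eventually_forall_of_forall_eventually fun z hz => ?_
  have hc : ContinuousAt (fun z : minimalConformalClass g ×
      (EuclideanSpace ℝ (Fin d) × EuclideanSpace ℝ (Fin d)) =>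
      degeneracy g z.1 p z.2.1 z.2.2) (g', z) := by
    have h1 : ContinuousAt (fun z : RiemMetric m d M ×
      (EuclideanSpace ℝ (Fin d) × EuclideanSpace ℝ (Fin d)) => degeneracy g z.1 p z.2.1 z.2.2)
      ((g' : RiemMetric m d M), z) := hcont.continuousAt (by
        refine prod_mem_nhds Filter.univ_mem (prod_mem_nhds (hV.mem_nhds (hKp hz.1)) Filter.univ_mem))
    exact ContinuousAt.comp (f := fun z : minimalConformalClass g ×
      (EuclideanSpace ℝ (Fin d) × EuclideanSpace ℝ (Fin d)) => ((z.1 : RiemMetric m d M), z.2))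
      (x := (g', z)) h1 ((continuous_subtype_val.comp continuous_fst).prodMk
        continuous_snd).continuousAt
  exact hc.eventually_ne (hg' z hz)

end Openness

/-! ### The Morse condition in a finite family of charts -/

section Cover

variable {m d : ℕ} {M : Type*} [TopologicalSpace M]
  [ChartedSpace (EuclideanHalfSpace (d + 1)) M] [IsManifold (𝓡∂ (d + 1)) 1 M]
  [h : IsManifold (𝓡∂ (d + 1)) ((m + 1 : ℕ) : WithTop ℕ∞) M]

/-- The projection `(y₀, y) ↦ y`. -/
def boundaryProj (d : ℕ) : EuclideanSpace ℝ (Fin (d + 1)) →L[ℝ] EuclideanSpace ℝ (Fin d) :=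
  LinearMap.toContinuousLinearMap
    { toFun := fun y => WithLp.toLp 2 fun i => y i.succ
      map_add' := fun _ _ => rfl
      map_smul' := fun _ _ => rfl }

@[simp] lemma boundaryProj_boundaryIncl (y : EuclideanSpace ℝ (Fin d)) :
    boundaryProj d (boundaryIncl d y) = y := rfl

lemma boundaryIncl_boundaryProj {y : EuclideanSpace ℝ (Fin (d + 1))} (hy : y 0 = 0) :
    boundaryIncl d (boundaryProj d y) = y := by
  ext i
  refine Fin.cases ?_ (fun i => ?_) i
  · exact hy.symm
  · rfl

omit h in
-- The restriction of the transition map to the boundary is a C² change of coordinates. Its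
-- derivative is injective, since the full derivative is invertible and preserves tangential
-- vectors, and then bijective by equality of dimensions.
lemma nondegenerateAt_boundaryRep_of_mem [IsManifold (𝓡∂ (d + 1)) 2 M] {f : M → ℝ} {p q : M}
    (hf : ContDiffOn ℝ 2 (boundaryRep f q) (boundaryDomain d q))
    {y : EuclideanSpace ℝ (Fin d)} (hy : y ∈ boundaryDomain d p)
    (hq : (extChartAt (𝓡∂ (d + 1)) p).symm (boundaryIncl d y) ∈
      (extChartAt (𝓡∂ (d + 1)) q).source)
    (hn : NondegenerateAt (boundaryRep f q)
      (boundaryProj d (transition p q (boundaryIncl d y)))) :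
    NondegenerateAt (boundaryRep f p) y := by
  set x := (extChartAt (𝓡∂ (d + 1)) p).symm (boundaryIncl d y) with hx
  have hp : x ∈ (extChartAt (𝓡∂ (d + 1)) p).source := (extChartAt _ p).map_target hy
  have hb : x ∈ (𝓡∂ (d + 1)).boundary M := symm_mem_boundary hy
  have hpx : extChartAt (𝓡∂ (d + 1)) p x = boundaryIncl d y := PartialEquiv.right_inv _ hy
  have hid : ∀ z ∈ boundaryDomain d p,
      (extChartAt (𝓡∂ (d + 1)) p).symm (boundaryIncl d z) ∈ (extChartAt (𝓡∂ (d + 1)) q).source →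
      boundaryIncl d (boundaryProj d (transition p q (boundaryIncl d z))) =
        transition p q (boundaryIncl d z) := fun z hz hzq =>
    boundaryIncl_boundaryProj ((mem_boundary_iff_of_mem_source hzq).1 (symm_mem_boundary hz))
  have hι : Filter.Tendsto (boundaryIncl d) (𝓝 y) (𝓝[range (𝓡∂ (d + 1))] (boundaryIncl d y)) :=
    tendsto_nhdsWithin_iff.2 ⟨(boundaryIncl d).continuous.continuousAt,
      Filter.Eventually.of_forall fun z => mem_range_halfSpace.2 (by simp)⟩
  have hιr : MapsTo (boundaryIncl d) univ (range (𝓡∂ (d + 1))) := fun z _ =>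
    mem_range_halfSpace.2 (by simp)
  have hτ : ContDiffWithinAt ℝ 2 (transition p q) (range (𝓡∂ (d + 1))) (boundaryIncl d y) := by
    refine contDiffWithinAt_ext_coord_change q p ?_
    rw [PartialEquiv.trans_source'', PartialEquiv.symm_symm, PartialEquiv.symm_target]
    exact ⟨x, ⟨hp, hq⟩, hpx⟩
  have hψ : ContDiffAt ℝ 2 (fun z => boundaryProj d (transition p q (boundaryIncl d z))) y :=
    (boundaryProj d).contDiff.contDiffAt.comp y (contDiffWithinAt_univ.1
      (hτ.comp y (boundaryIncl d).contDiff.contDiffAt.contDiffWithinAt hιr))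
  have hJ := hasFDerivWithinAt_tangentCoordChange (I := 𝓡∂ (d + 1)) ⟨hp, hq⟩
  rw [hpx] at hJ
  have hψ' : HasFDerivAt (fun z => boundaryProj d (transition p q (boundaryIncl d z)))
      ((boundaryProj d).comp ((tangentCoordChange (𝓡∂ (d + 1)) p q x).comp (boundaryIncl d))) y :=
    (boundaryProj d).hasFDerivAt.comp y (hasFDerivWithinAt_univ.1
      (hJ.comp y (boundaryIncl d).hasFDerivAt.hasFDerivWithinAt hιr))
  have hinj : Function.Injective ((boundaryProj d).comp
      ((tangentCoordChange (𝓡∂ (d + 1)) p q x).comp (boundaryIncl d))) := by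
    refine (injective_iff_map_eq_zero _).2 fun v hv => ?_
    have h1 := tangentCoordChange_apply_zero hq hp hb (v := boundaryIncl d v) (by simp)
    have h2 := boundaryIncl_boundaryProj h1
    have h3 : boundaryProj d (tangentCoordChange (𝓡∂ (d + 1)) p q x (boundaryIncl d v)) = 0 := hv
    rw [h3, map_zero] at h2
    have h4 := tangentCoordChange_symm hp hq (boundaryIncl d v)
    rw [← h2, map_zero] at h4
    rw [← boundaryProj_boundaryIncl v, ← h4, map_zero]
  have hmem : boundaryProj d (transition p q (boundaryIncl d y)) ∈ boundaryDomain d q := by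
    rw [boundaryDomain, mem_preimage, hid y hy hq]
    exact (extChartAt _ q).map_source hq
  refine NondegenerateAt.comp (ψ := fun z => boundaryProj d (transition p q (boundaryIncl d z)))
    hn (hf.contDiffAt ((isOpen_boundaryDomain q).mem_nhds hmem)) hψ ?_ ?_
  · rw [hψ'.fderiv]
    exact ⟨hinj, (LinearMap.injective_iff_surjective (f := ((boundaryProj d).comp
      ((tangentCoordChange (𝓡∂ (d + 1)) p q x).comp (boundaryIncl d)) :
      EuclideanSpace ℝ (Fin d) →ₗ[ℝ] EuclideanSpace ℝ (Fin d)))).1 hinj⟩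
  · have h1 := eventually_mem_target_inter (d := d) hq hp
    rw [hpx] at h1
    filter_upwards [hι.eventually h1] with z hz
    simp only [Function.comp, boundaryRep_apply]
    rw [hid z hz.1 hz.2]
    simp only [transition, Function.comp]
    rw [PartialEquiv.left_inv _ hz.2]

/-- The set of boundary coordinates at distance at most `r` from the base point of the chart. -/
def boundaryBall (d : ℕ) {M : Type*} [TopologicalSpace M]
    [ChartedSpace (EuclideanHalfSpace (d + 1)) M] (p : M) (r : ℝ) :
    Set (EuclideanSpace ℝ (Fin d)) :=
  boundaryIncl d ⁻¹' Metric.closedBall (extChartAt (𝓡∂ (d + 1)) p p) r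

omit [IsManifold (𝓡∂ (d + 1)) 1 M] h in
lemma isCompact_boundaryBall (p : M) (r : ℝ) : IsCompact (boundaryBall d p r) := by
  refine Metric.isCompact_of_isClosed_isBounded
    (Metric.isClosed_closedBall.preimage (boundaryIncl d).continuous) ?_
  refine (Metric.isBounded_iff_subset_closedBall 0).2
    ⟨‖extChartAt (𝓡∂ (d + 1)) p p‖ + r, fun y hy => ?_⟩
  have h1 : dist (boundaryIncl d y) (extChartAt (𝓡∂ (d + 1)) p p) ≤ r := hy
  rw [mem_closedBall_zero_iff, ← norm_boundaryIncl]
  rw [dist_eq_norm] at h1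
  exact (norm_le_insert' _ _).trans (add_le_add_right h1 _)

omit [IsManifold (𝓡∂ (d + 1)) 1 M] h in
lemma boundaryBall_subset {p : M} {r : ℝ}
    (hr : Metric.closedBall (extChartAt (𝓡∂ (d + 1)) p p) r ∩ range (𝓡∂ (d + 1)) ⊆
      (extChartAt (𝓡∂ (d + 1)) p).target) : boundaryBall d p r ⊆ boundaryDomain d p :=
  fun _ hy => hr ⟨hy, mem_range_halfSpace.2 (by simp)⟩

omit [IsManifold (𝓡∂ (d + 1)) 1 M] h in
variable (d) in
lemma exists_finite_cover [CompactSpace M] {r : M → ℝ} (hr : ∀ p, 0 < r p) :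
    ∃ T : Finset M, ∀ x : M, ∃ p ∈ T, x ∈ (extChartAt (𝓡∂ (d + 1)) p).source ∧
      extChartAt (𝓡∂ (d + 1)) p x ∈ Metric.closedBall (extChartAt (𝓡∂ (d + 1)) p p) (r p) := by
  have hU : ∀ p : M, (extChartAt (𝓡∂ (d + 1)) p).source ∩ extChartAt (𝓡∂ (d + 1)) p ⁻¹'
      Metric.closedBall (extChartAt (𝓡∂ (d + 1)) p p) (r p) ∈ 𝓝 p := fun p =>
    Filter.inter_mem (extChartAt_source_mem_nhds p)
      ((continuousAt_extChartAt p).preimage_mem_nhds (Metric.closedBall_mem_nhds _ (hr p)))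
  obtain ⟨T, -, hT⟩ := isCompact_univ.elim_nhds_subcover _ fun p _ => hU p
  refine ⟨T, fun x => ?_⟩
  obtain ⟨p, hp, hx⟩ := mem_iUnion₂.1 (hT (mem_univ x))
  exact ⟨p, hp, hx.1, hx.2⟩

/-- Both directions transport non-degeneracy between the preferred chart at a boundary point and the
chart of the cover containing it. -/
lemma isMorseOnBoundary_iff (hm : 3 ≤ m) (g : RiemMetric m d M) {r : M → ℝ} {T : Finset M}
    (hr : ∀ p, Metric.closedBall (extChartAt (𝓡∂ (d + 1)) p p) (r p) ∩ range (𝓡∂ (d + 1)) ⊆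
      (extChartAt (𝓡∂ (d + 1)) p).target)
    (hT : ∀ x : M, ∃ p ∈ T, x ∈ (extChartAt (𝓡∂ (d + 1)) p).source ∧
      extChartAt (𝓡∂ (d + 1)) p x ∈ Metric.closedBall (extChartAt (𝓡∂ (d + 1)) p p) (r p)) :
    IsMorseOnBoundary d (normSqSecondFundamentalForm g) ↔ ∀ p ∈ T, ∀ y ∈ boundaryBall d p (r p),
      NondegenerateAt (boundaryRep (normSqSecondFundamentalForm g) p) y := by
  have : IsManifold (𝓡∂ (d + 1)) 2 M := IsManifold.of_le (n := ((m + 1 : ℕ) : WithTop ℕ∞))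
    (by exact_mod_cast (by omega : 2 ≤ m + 1))
  have hf : ∀ p : M, ContDiffOn ℝ 2 (boundaryRep (normSqSecondFundamentalForm g) p)
      (boundaryDomain d p) := fun p => by
    exact_mod_cast contDiffOn_boundaryRep_normSq (n := 2) hm g p
  constructor
  · intro hM p _ y hy
    have hy' := boundaryBall_subset (hr p) hy
    refine nondegenerateAt_boundaryRep_of_mem (hf _) hy' (mem_extChartAt_source _) ?_
    exact hM _ (symm_mem_boundary hy')
  · intro hM x hx
    obtain ⟨p, hp, hxs, hxb⟩ := hT x
    have h1 := boundaryIncl_boundaryCoord ((mem_boundary_iff x).1 hx)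
    have h2 : (extChartAt (𝓡∂ (d + 1)) x).symm (boundaryIncl d (boundaryCoord d x)) = x := by
      rw [h1, extChartAt_to_inv]
    refine nondegenerateAt_boundaryRep_of_mem (hf p) (boundaryCoord_mem hx) (by rwa [h2]) ?_
    refine hM p hp _ ?_
    have h3 : transition x p (boundaryIncl d (boundaryCoord d x)) =
        extChartAt (𝓡∂ (d + 1)) p x := by
      rw [transition, Function.comp, h2]
    rw [h3, boundaryBall, mem_preimage,
      boundaryIncl_boundaryProj ((mem_boundary_iff_of_mem_source hxs).1 hx)]
    exact hxb

end Cover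

/-! ### Functions with vanishing normal derivative -/

section Neumann

variable {m d : ℕ} {M : Type*} [TopologicalSpace M]
  [ChartedSpace (EuclideanHalfSpace (d + 1)) M]

/-- The function on `M` that is `W` in the preferred chart at `p`, and `0` off its domain. -/
def chartExtend (p : M) (W : EuclideanSpace ℝ (Fin (d + 1)) → ℝ) : M → ℝ :=
  (extChartAt (𝓡∂ (d + 1)) p).source.indicator fun x => W (extChartAt (𝓡∂ (d + 1)) p x)

/-- In a Hausdorff space the compact image of `K` is closed, so the extension by zero vanishes near
every point off the chart domain. -/
lemma chartExtend_eventuallyEq_zero [T2Space M] {p : M}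
    {W : EuclideanSpace ℝ (Fin (d + 1)) → ℝ} {K : Set (EuclideanSpace ℝ (Fin (d + 1)))}
    (hK : IsCompact K) (hKp : K ⊆ (extChartAt (𝓡∂ (d + 1)) p).target)
    (hWK : ∀ y ∈ (extChartAt (𝓡∂ (d + 1)) p).target, y ∉ K → W y = 0) {x : M}
    (hx : x ∉ (extChartAt (𝓡∂ (d + 1)) p).source) : chartExtend p W =ᶠ[𝓝 x] 0 := by
  have hC : IsClosed ((extChartAt (𝓡∂ (d + 1)) p).symm '' K) :=
    (hK.image_of_continuousOn ((continuousOn_extChartAt_symm p).mono hKp)).isClosed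
  have hxC : x ∉ (extChartAt (𝓡∂ (d + 1)) p).symm '' K := by
    rintro ⟨y, hy, rfl⟩
    exact hx ((extChartAt _ p).map_target (hKp hy))
  filter_upwards [hC.isOpen_compl.mem_nhds hxC] with z hz
  by_cases hzs : z ∈ (extChartAt (𝓡∂ (d + 1)) p).source
  · rw [chartExtend, indicator_of_mem hzs]
    exact hWK _ ((extChartAt _ p).map_source hzs) fun hzK =>
      hz ⟨_, hzK, (extChartAt _ p).left_inv hzs⟩
  · exact indicator_of_notMem hzs _

lemma contMDiff_chartExtend [T2Space M] [IsManifold (𝓡∂ (d + 1)) (m : WithTop ℕ∞) M] {p : M}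
    {W : EuclideanSpace ℝ (Fin (d + 1)) → ℝ} {K : Set (EuclideanSpace ℝ (Fin (d + 1)))}
    (hK : IsCompact K) (hKp : K ⊆ (extChartAt (𝓡∂ (d + 1)) p).target)
    (hW : ContDiffOn ℝ m W (extChartAt (𝓡∂ (d + 1)) p).target)
    (hWK : ∀ y ∈ (extChartAt (𝓡∂ (d + 1)) p).target, y ∉ K → W y = 0) :
    ContMDiff (𝓡∂ (d + 1)) 𝓘(ℝ, ℝ) m (chartExtend p W) := by
  intro x
  by_cases hx : x ∈ (extChartAt (𝓡∂ (d + 1)) p).source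
  · have h1 : ContMDiffOn (𝓡∂ (d + 1)) 𝓘(ℝ, ℝ) m (fun x => W (extChartAt (𝓡∂ (d + 1)) p x))
        (extChartAt (𝓡∂ (d + 1)) p).source :=
      hW.contMDiffOn.comp (by
        rw [extChartAt_source]
        exact contMDiffOn_extChartAt) fun y hy => (extChartAt _ p).map_source hy
    have h2 := (isOpen_extChartAt_source p).mem_nhds hx
    exact (h1.contMDiffAt h2).congr_of_eventuallyEq
      (Filter.mem_of_superset h2 fun z hz => indicator_of_mem hz _)
  · exact contMDiffAt_const.congr_of_eventuallyEq (chartExtend_eventuallyEq_zero hK hKp hWK hx)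

variable [IsManifold (𝓡∂ (d + 1)) 1 M] [h : IsManifold (𝓡∂ (d + 1)) ((m + 1 : ℕ) : WithTop ℕ∞) M]

/-- A function that agrees with `W` for `y₀ = 0` and whose derivative in the direction of the
normal of `g` vanishes there. -/
def neumannCorrection (g : RiemMetric m d M) (p : M) (W : EuclideanSpace ℝ (Fin (d + 1)) → ℝ)
    (y : EuclideanSpace ℝ (Fin (d + 1))) : ℝ :=
  W y - y 0 * (fderiv ℝ W y (normalAt g p y) / normalAt g p y 0)

omit h in
lemma normalAt_zero_ne (g : RiemMetric m d M) {p : M} {y : EuclideanSpace ℝ (Fin (d + 1))}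
    (hy : y ∈ (extChartAt (𝓡∂ (d + 1)) p).target) : normalAt g p y 0 ≠ 0 := by
  rw [normalAt_zero]
  exact neg_ne_zero.2 (Real.sqrt_pos.2 (gramAt_inv_zero_pos g p hy)).ne'

lemma contDiffOn_neumannCorrection_coeff (g : RiemMetric m d M) (p : M)
    {W : EuclideanSpace ℝ (Fin (d + 1)) → ℝ} (hW : ContDiff ℝ ∞ W) :
    ContDiffOn ℝ m (fun y => fderiv ℝ W y (normalAt g p y) / normalAt g p y 0)
      (extChartAt (𝓡∂ (d + 1)) p).target := by
  have h1 : ContDiff ℝ m (fderiv ℝ W) := hW.fderiv_right (by exact_mod_cast le_top)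
  exact (h1.contDiffOn.clm_apply (contDiffOn_normalAt g p)).div
    (contDiffOn_euclidean.1 (contDiffOn_normalAt g p) 0) fun y hy => normalAt_zero_ne g hy

lemma contDiffOn_neumannCorrection (g : RiemMetric m d M) (p : M)
    {W : EuclideanSpace ℝ (Fin (d + 1)) → ℝ} (hW : ContDiff ℝ ∞ W) :
    ContDiffOn ℝ m (neumannCorrection g p W) (extChartAt (𝓡∂ (d + 1)) p).target := by
  have h0 : ContDiff ℝ m fun y : EuclideanSpace ℝ (Fin (d + 1)) => y 0 := by fun_prop
  exact (hW.of_le (by exact_mod_cast le_top)).contDiffOn.sub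
    (h0.contDiffOn.mul (contDiffOn_neumannCorrection_coeff g p hW))

/-- Where y₀ = 0, the derivative of the subtracted product along ν is ν₀ · dW(ν)/ν₀, which cancels
dW(ν). -/
lemma exists_hasFDerivWithinAt_neumannCorrection (hm : 1 ≤ m) (g : RiemMetric m d M) {p : M}
    {W : EuclideanSpace ℝ (Fin (d + 1)) → ℝ} (hW : ContDiff ℝ ∞ W)
    {y : EuclideanSpace ℝ (Fin (d + 1))} (hy : y ∈ (extChartAt (𝓡∂ (d + 1)) p).target)
    (hy0 : y 0 = 0) :
    ∃ L : EuclideanSpace ℝ (Fin (d + 1)) →L[ℝ] ℝ,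
      HasFDerivWithinAt (neumannCorrection g p W) L (range (𝓡∂ (d + 1))) y ∧
        L (normalAt g p y) = 0 := by
  have h1 := ((contDiffOn_neumannCorrection_coeff g p hW y hy).differentiableWithinAt
    (by exact_mod_cast (Nat.one_le_iff_ne_zero.1 hm))).mono_of_mem_nhdsWithin
    (extChartAt_target_mem_nhdsWithin_of_mem hy)
  have h2 : HasFDerivWithinAt W (fderiv ℝ W y) (range (𝓡∂ (d + 1))) y :=
    ((hW.differentiable (by simp)) y).hasFDerivAt.hasFDerivWithinAt
  have h3 : HasFDerivWithinAt (fun y : EuclideanSpace ℝ (Fin (d + 1)) => y 0)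
      (EuclideanSpace.proj (𝕜 := ℝ) (0 : Fin (d + 1))) (range (𝓡∂ (d + 1))) y :=
    (EuclideanSpace.proj (𝕜 := ℝ) (0 : Fin (d + 1))).hasFDerivWithinAt
  refine ⟨_, h2.sub (h3.mul h1.hasFDerivWithinAt), ?_⟩
  have h4 : EuclideanSpace.proj (𝕜 := ℝ) (0 : Fin (d + 1)) (normalAt g p y) = normalAt g p y 0 :=
    rfl
  simp only [hy0, zero_smul, zero_add, sub_apply, smul_apply, smul_eq_mul, h4]
  rw [div_mul_cancel₀ _ (normalAt_zero_ne g hy), sub_self]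

/-- The normal in the preferred chart at `x` corresponds to a multiple of the normal in the chart at
`p`, along which the corrected function has zero derivative. -/
lemma normalDeriv_chartExtend [T2Space M] (hm : 1 ≤ m) (g : RiemMetric m d M) {p : M}
    {W : EuclideanSpace ℝ (Fin (d + 1)) → ℝ} (hW : ContDiff ℝ ∞ W)
    {K : Set (EuclideanSpace ℝ (Fin (d + 1)))} (hK : IsCompact K)
    (hKp : K ⊆ (extChartAt (𝓡∂ (d + 1)) p).target)
    (hWK : ∀ y ∈ (extChartAt (𝓡∂ (d + 1)) p).target, y ∉ K → neumannCorrection g p W y = 0)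
    (w : C^m⟮𝓡∂ (d + 1), M; 𝓘(ℝ, ℝ), ℝ⟯) (hw : ⇑w = chartExtend p (neumannCorrection g p W))
    {x : M} (hx : x ∈ (𝓡∂ (d + 1)).boundary M) : normalDeriv g w x = 0 := by
  by_cases hxp : x ∈ (extChartAt (𝓡∂ (d + 1)) p).source
  · obtain ⟨L, hL, hL0⟩ := exists_hasFDerivWithinAt_neumannCorrection hm g hW
      ((extChartAt _ p).map_source hxp) ((mem_boundary_iff_of_mem_source hxp).1 hx)
    have hxx := mem_extChartAt_source (I := 𝓡∂ (d + 1)) x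
    have h1 := hasFDerivWithinAt_tangentCoordChange (I := 𝓡∂ (d + 1)) ⟨hxx, hxp⟩
    have hpt : (extChartAt (𝓡∂ (d + 1)) p ∘ (extChartAt (𝓡∂ (d + 1)) x).symm)
        (extChartAt (𝓡∂ (d + 1)) x x) = extChartAt (𝓡∂ (d + 1)) p x := by
      rw [Function.comp, extChartAt_to_inv]
    rw [← hpt] at hL
    have h2 := hL.comp _ h1 fun z _ => mem_range_self _
    have h3 := hasFDerivWithinAt_chartRep w hm x
    have h4 : (fun y => w ((extChartAt (𝓡∂ (d + 1)) x).symm y))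
        =ᶠ[𝓝[range (𝓡∂ (d + 1))] extChartAt (𝓡∂ (d + 1)) x x]
        neumannCorrection g p W ∘ (extChartAt (𝓡∂ (d + 1)) p ∘ (extChartAt (𝓡∂ (d + 1)) x).symm) := by
      filter_upwards [eventually_mem_target_inter (d := d) hxp hxx] with z hz
      rw [hw, chartExtend, indicator_of_mem hz.2]
      rfl
    have h5 := h2.congr_of_eventuallyEq h4 (h4.self_of_nhdsWithin (mem_range_self _))
    have h6 := ((𝓡∂ (d + 1)).uniqueDiffOn _ (mem_range_self _)).eq h3 h5
    obtain ⟨c, -, hc⟩ := tangentCoordChange_normalAt g hxp hxx hx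
    have h7 : normalDeriv g w x = coordDiff w x (normalAt g x (extChartAt (𝓡∂ (d + 1)) x x)) := rfl
    rw [h7, h6, ContinuousLinearMap.comp_apply, hc, map_smul, hL0, smul_zero]
  · have h1 : ⇑w =ᶠ[𝓝 x] fun _ => (0 : ℝ) := by
      rw [hw]
      exact chartExtend_eventuallyEq_zero hK hKp hWK hxp
    rw [normalDeriv, h1.mfderiv_eq, mfderiv_const]
    rfl

lemma exists_normalDeriv_eq_zero_extension [T2Space M] (hm : 1 ≤ m) (g : RiemMetric m d M) {p : M}
    {R : ℝ} (hR : Metric.closedBall (extChartAt (𝓡∂ (d + 1)) p p) R ∩ range (𝓡∂ (d + 1)) ⊆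
      (extChartAt (𝓡∂ (d + 1)) p).target)
    {W : EuclideanSpace ℝ (Fin (d + 1)) → ℝ} (hW : ContDiff ℝ ∞ W)
    (hWR : ∀ y ∉ Metric.closedBall (extChartAt (𝓡∂ (d + 1)) p p) R, W y = 0) :
    ∃ w : C^m⟮𝓡∂ (d + 1), M; 𝓘(ℝ, ℝ), ℝ⟯,
      (∀ x ∈ (𝓡∂ (d + 1)).boundary M, normalDeriv g w x = 0) ∧
      ∀ y ∈ boundaryDomain d p,
        w ((extChartAt (𝓡∂ (d + 1)) p).symm (boundaryIncl d y)) = W (boundaryIncl d y) := by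
  have : IsManifold (𝓡∂ (d + 1)) (m : WithTop ℕ∞) M :=
    IsManifold.of_le (n := ((m + 1 : ℕ) : WithTop ℕ∞)) (by exact_mod_cast Nat.le_succ m)
  set K := Metric.closedBall (extChartAt (𝓡∂ (d + 1)) p p) R ∩ range (𝓡∂ (d + 1))
  have hK : IsCompact K := (isCompact_closedBall _ R).inter_right (𝓡∂ (d + 1)).isClosed_range
  have hWK : ∀ y ∈ (extChartAt (𝓡∂ (d + 1)) p).target, y ∉ K → neumannCorrection g p W y = 0 := by
    intro y hy hyK
    have hyR : y ∉ Metric.closedBall (extChartAt (𝓡∂ (d + 1)) p p) R := fun h' =>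
      hyK ⟨h', extChartAt_target_subset_range p hy⟩
    have h1 : W =ᶠ[𝓝 y] fun _ => 0 := by
      filter_upwards [Metric.isClosed_closedBall.isOpen_compl.mem_nhds hyR] with z hz
      exact hWR z hz
    simp [neumannCorrection, h1.fderiv_eq, hWR y hyR]
  refine ⟨⟨chartExtend p (neumannCorrection g p W), contMDiff_chartExtend hK hR
    (contDiffOn_neumannCorrection g p hW) hWK⟩, fun x hx =>
    normalDeriv_chartExtend hm g hW hK hR hWK _ rfl hx, fun y hy => ?_⟩
  change chartExtend p (neumannCorrection g p W) _ = _
  rw [chartExtend, indicator_of_mem ((extChartAt _ p).map_target hy), PartialEquiv.right_inv _ hy,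
    neumannCorrection, boundaryIncl_zero, zero_mul, sub_zero]

/-- The function `u + ∑ tⱼ wⱼ`. -/
def linearFamily (u : C^m⟮𝓡∂ (d + 1), M; 𝓘(ℝ, ℝ), ℝ⟯)
    (w : Fin d → C^m⟮𝓡∂ (d + 1), M; 𝓘(ℝ, ℝ), ℝ⟯) (t : EuclideanSpace ℝ (Fin d)) :
    C^m⟮𝓡∂ (d + 1), M; 𝓘(ℝ, ℝ), ℝ⟯ :=
  ⟨fun x => u x + ∑ j, t j * w j x, u.contMDiff.add (contMDiff_finsetSum fun j _ =>
    contMDiff_const.mul (w j).contMDiff)⟩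

omit [IsManifold (𝓡∂ (d + 1)) 1 M] h in
lemma linearFamily_apply (u : C^m⟮𝓡∂ (d + 1), M; 𝓘(ℝ, ℝ), ℝ⟯)
    (w : Fin d → C^m⟮𝓡∂ (d + 1), M; 𝓘(ℝ, ℝ), ℝ⟯) (t : EuclideanSpace ℝ (Fin d)) (x : M) :
    linearFamily u w t x = u x + ∑ j, t j * w j x := rfl

omit [IsManifold (𝓡∂ (d + 1)) 1 M] h in
lemma linearFamily_zero (u : C^m⟮𝓡∂ (d + 1), M; 𝓘(ℝ, ℝ), ℝ⟯)
    (w : Fin d → C^m⟮𝓡∂ (d + 1), M; 𝓘(ℝ, ℝ), ℝ⟯) : linearFamily u w 0 = u :=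
  ContMDiffMap.coe_injective (funext fun x => by simp [linearFamily_apply])

omit h in
lemma normalDeriv_linearFamily (hm : 1 ≤ m) (g : RiemMetric m d M)
    {u : C^m⟮𝓡∂ (d + 1), M; 𝓘(ℝ, ℝ), ℝ⟯} {w : Fin d → C^m⟮𝓡∂ (d + 1), M; 𝓘(ℝ, ℝ), ℝ⟯} {x : M}
    (hu : normalDeriv g u x = 0) (hw : ∀ j, normalDeriv g (w j) x = 0)
    (t : EuclideanSpace ℝ (Fin d)) : normalDeriv g (linearFamily u w t) x = 0 := by
  have h1 := (hasFDerivWithinAt_chartRep u hm x).fun_add (HasFDerivWithinAt.fun_sum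
    (u := Finset.univ) fun j _ => (hasFDerivWithinAt_chartRep (w j) hm x).const_mul (t j))
  have h2 := ((𝓡∂ (d + 1)).uniqueDiffOn _ (mem_range_self _)).eq
    (hasFDerivWithinAt_chartRep (linearFamily u w t) hm x) h1
  change coordDiff _ x (normalAt g x (extChartAt (𝓡∂ (d + 1)) x x)) = 0
  rw [h2]
  replace hu : coordDiff u x (normalAt g x (extChartAt (𝓡∂ (d + 1)) x x)) = 0 := hu
  replace hw : ∀ j, coordDiff (w j) x (normalAt g x (extChartAt (𝓡∂ (d + 1)) x x)) = 0 := hw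
  simp only [add_apply, sum_apply, smul_apply, smul_eq_mul, hu, hw, mul_zero,
    Finset.sum_const_zero, add_zero]

omit [IsManifold (𝓡∂ (d + 1)) 1 M] in
lemma contDiffOn_comp_extChartAt_symm (u : C^m⟮𝓡∂ (d + 1), M; 𝓘(ℝ, ℝ), ℝ⟯) (p : M) :
    ContDiffOn ℝ m (fun y => u ((extChartAt (𝓡∂ (d + 1)) p).symm y))
      (extChartAt (𝓡∂ (d + 1)) p).target := by
  have : IsManifold (𝓡∂ (d + 1)) (m : WithTop ℕ∞) M :=
    IsManifold.of_le (n := ((m + 1 : ℕ) : WithTop ℕ∞)) (by exact_mod_cast Nat.le_succ m)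
  exact (u.contMDiff.comp_contMDiffOn (contMDiffOn_extChartAt_symm p)).contDiffOn

/-- The components are jointly C^m in `t` and the coordinates, so their derivatives in the
coordinates are jointly continuous, hence vary uniformly on compact sets as `t` varies. -/
lemma continuous_conformalMetric_linearFamily (g : RiemMetric m d M)
    (u : C^m⟮𝓡∂ (d + 1), M; 𝓘(ℝ, ℝ), ℝ⟯) (w : Fin d → C^m⟮𝓡∂ (d + 1), M; 𝓘(ℝ, ℝ), ℝ⟯) :
    Continuous fun t => conformalMetric g (linearFamily u w t) := by
  refine continuous_iInf_rng.2 fun p => continuous_iInf_rng.2 fun i => continuous_iInf_rng.2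
    fun j => continuous_iInf_rng.2 fun k => continuous_induced_rng.2 ?_
  have hU := uniqueDiffOn_extChartAt_target (I := 𝓡∂ (d + 1)) p
  have hH : ContDiffOn ℝ m (Function.uncurry fun (t : EuclideanSpace ℝ (Fin d))
      (y : EuclideanSpace ℝ (Fin (d + 1))) =>
      metricComp (conformalMetric g (linearFamily u w t)) p i j y)
      (univ ×ˢ (extChartAt (𝓡∂ (d + 1)) p).target) := by
    have hs : ∀ {f : EuclideanSpace ℝ (Fin (d + 1)) → ℝ},
        ContDiffOn ℝ m f (extChartAt (𝓡∂ (d + 1)) p).target →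
        ContDiffOn ℝ m (fun z : EuclideanSpace ℝ (Fin d) × EuclideanSpace ℝ (Fin (d + 1)) => f z.2)
          (univ ×ˢ (extChartAt (𝓡∂ (d + 1)) p).target) := fun hf =>
      hf.comp contDiff_snd.contDiffOn fun z hz => hz.2
    have ht : ∀ a, ContDiffOn ℝ m (fun z : EuclideanSpace ℝ (Fin d) ×
        EuclideanSpace ℝ (Fin (d + 1)) => z.1 a)
        (univ ×ˢ (extChartAt (𝓡∂ (d + 1)) p).target) := fun a => by fun_prop
    simp only [Function.uncurry_def, metricComp_conformalMetric, linearFamily_apply]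
    exact ((contDiffOn_const.mul ((hs (contDiffOn_comp_extChartAt_symm u p)).add
      (ContDiffOn.sum fun a _ => (ht a).mul (hs (contDiffOn_comp_extChartAt_symm (w a) p))))).exp.mul
      (hs (contDiffOn_metricComp g p i j)))
  have hc := continuousOn_iteratedFDerivWithin_param hU (k : ℕ)
    (hH.of_le (by exact_mod_cast Nat.lt_succ_iff.1 k.2))
  refine continuous_iff_continuousAt.2 fun t => ?_
  refine UniformOnFun.tendsto_iff_tendstoUniformlyOn.2 fun K hK s hs => ?_
  obtain ⟨v, hv, hvs⟩ := hK.1.mem_uniformity_of_prod (f := fun t y => iteratedFDerivWithin ℝ (k : ℕ)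
    (metricComp (conformalMetric g (linearFamily u w t)) p i j)
    (extChartAt (𝓡∂ (d + 1)) p).target y) (s := univ) (hc.mono (prod_mono_right hK.2)) (mem_univ t)
    (UniformSpace.symm hs)
  rw [nhdsWithin_univ] at hv
  filter_upwards [hv] with t' ht' y hy
  exact hvs t' ht' y hy

end Neumann

/-! ### Density -/

section Density

/-- After multiplication by `exp (-2 ⟪t, ·⟫)`, with `t` outside a null set, all the critical points
of a positive function are non-degenerate. -/
lemma dense_nondegenerateAt_mul_exp {d : ℕ} {f : EuclideanSpace ℝ (Fin d) → ℝ}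
    {V : Set (EuclideanSpace ℝ (Fin d))} (hV : IsOpen V) (hf : ContDiffOn ℝ 2 f V)
    (hpos : ∀ y ∈ V, 0 < f y) :
    Dense {t : EuclideanSpace ℝ (Fin d) | ∀ y ∈ V, ∀ F : EuclideanSpace ℝ (Fin d) → ℝ,
      (∀ z ∈ V, F z = Real.exp (-2 * innerSL ℝ t z) * f z) → NondegenerateAt F y} := by
  -- Half the logarithm, so that exp(-2⟨t, y⟩) f = exp(2(L − ⟨t, y⟩)): critical points solve ∇L = t
  -- and the Hessian there is a positive multiple of that of `L`.
  set L : EuclideanSpace ℝ (Fin d) → ℝ := fun y => Real.log (f y) / 2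
  have hL : ContDiffOn ℝ 2 L V := (hf.log fun y hy => (hpos y hy).ne').div_const 2
  have hLd : ∀ z ∈ V, DifferentiableAt ℝ L z := fun z hz =>
    (hL.contDiffAt (hV.mem_nhds hz)).differentiableAt (by simp)
  refine Dense.mono ?_ (MeasureTheory.Measure.dense_of_ae (μ := MeasureTheory.volume)
    (MeasureTheory.ae_iff.2 (by simpa only [not_not] using ae_nondegenerateAt_sub_linear hV hL) :
      ∀ᵐ t, ¬ ∃ y ∈ V, fderiv ℝ L y = innerSL ℝ t ∧
        ∃ v ≠ 0, ∀ w, fderiv ℝ (fderiv ℝ L) y v w = 0))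
  intro t ht y hy F hF
  have hLd2 : DifferentiableAt ℝ (fderiv ℝ L) y :=
    ((hL.contDiffAt (hV.mem_nhds hy)).fderiv_right (m := 1) (by norm_num)).differentiableAt
      one_ne_zero
  have hexp : ∀ z ∈ V, HasFDerivAt (fun z => Real.exp (2 * (L z - innerSL ℝ t z)))
      (Real.exp (2 * (L z - innerSL ℝ t z)) • ((2 : ℝ) • (fderiv ℝ L z - innerSL ℝ t))) z :=
    fun z hz => (((hLd z hz).hasFDerivAt.fun_sub (innerSL ℝ t).hasFDerivAt).const_mul 2).exp
  have hFe : ∀ z ∈ V, F z = Real.exp (2 * (L z - innerSL ℝ t z)) := fun z hz => by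
    have h1 : 2 * (L z - innerSL ℝ t z) = -2 * innerSL ℝ t z + Real.log (f z) := by
      simp only [L]; ring
    rw [hF z hz, h1, Real.exp_add, Real.exp_log (hpos z hz)]
  have hfd : ∀ᶠ z in 𝓝 y, fderiv ℝ F z =
      (2 * Real.exp (2 * (L z - innerSL ℝ t z))) • (fderiv ℝ L z - innerSL ℝ t) := by
    filter_upwards [hV.mem_nhds hy] with z hz
    have h1 : F =ᶠ[𝓝 z] fun z => Real.exp (2 * (L z - innerSL ℝ t z)) := by
      filter_upwards [hV.mem_nhds hz] with w hw using hFe w hw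
    rw [h1.fderiv_eq, (hexp z hz).fderiv, smul_smul, mul_comm]
  rw [nondegenerateAt_iff_of_fderiv_eq_smul hfd ((hexp y hy).differentiableAt.const_mul 2)
    (hLd2.sub_const _) (by positivity)]
  intro h0 v hv
  rw [fderiv_sub_const] at hv
  by_contra hv0
  exact ht ⟨y, hy, sub_eq_zero.1 h0, v, hv0, hv⟩

variable {m d : ℕ} {M : Type*} [TopologicalSpace M]
  [ChartedSpace (EuclideanHalfSpace (d + 1)) M] [IsManifold (𝓡∂ (d + 1)) 1 M]
  [h : IsManifold (𝓡∂ (d + 1)) ((m + 1 : ℕ) : WithTop ℕ∞) M] {g : RiemMetric m d M}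

/-- Functions with vanishing normal derivative that agree near the centre of the chart at `p` with
the boundary coordinates. -/
lemma exists_coordinate_functions [T2Space M] (hm : 1 ≤ m) (g : RiemMetric m d M) {p : M} {r : ℝ}
    (hr0 : 0 < r)
    (hr : Metric.closedBall (extChartAt (𝓡∂ (d + 1)) p p) (3 * r) ∩ range (𝓡∂ (d + 1)) ⊆
      (extChartAt (𝓡∂ (d + 1)) p).target) (j : Fin d) :
    ∃ w : C^m⟮𝓡∂ (d + 1), M; 𝓘(ℝ, ℝ), ℝ⟯,
      (∀ x ∈ (𝓡∂ (d + 1)).boundary M, normalDeriv g w x = 0) ∧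
      ∀ y ∈ boundaryDomain d p,
        boundaryIncl d y ∈ Metric.ball (extChartAt (𝓡∂ (d + 1)) p p) (2 * r) →
        w ((extChartAt (𝓡∂ (d + 1)) p).symm (boundaryIncl d y)) = y j := by
  -- The condition is imposed on the ball of radius `r`; coordinates are exact on the open ball of
  -- radius `2 * r`, which contains a neighbourhood of it, and the cutoff to `3 * r` stays in the
  -- chart.
  let χ : ContDiffBump (extChartAt (𝓡∂ (d + 1)) p p) :=
    ⟨2 * r, 3 * r, by positivity, by linarith⟩
  have hc : ContDiff ℝ ∞ fun y : EuclideanSpace ℝ (Fin (d + 1)) => y j.succ := by fun_prop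
  obtain ⟨w, hw, hwW⟩ := exists_normalDeriv_eq_zero_extension hm g hr
    (W := fun y => χ y * y j.succ) (χ.contDiff.mul hc) (fun y hy => by
      rw [χ.zero_of_le_dist (not_le.1 hy).le, zero_mul])
  refine ⟨w, hw, fun y hy hyr => ?_⟩
  rw [hwW y hy, χ.one_of_mem_closedBall (Metric.ball_subset_closedBall hyr), one_mul,
    boundaryIncl_succ]

/-- A d-parameter family of minimal conformal metrics passes through the given one at `t = 0`, and
almost every parameter is good on the whole ball at once. -/
lemma dense_nondegenerate [T2Space M] (hm : 3 ≤ m) (hd : d ≠ 0) (hH : HasMinimalBoundary g)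
    (hII : ∀ p ∈ (𝓡∂ (d + 1)).boundary M, secondFundamentalForm g p ≠ 0) {p : M} {r : ℝ}
    (hr0 : 0 < r)
    (hr : Metric.closedBall (extChartAt (𝓡∂ (d + 1)) p p) (3 * r) ∩ range (𝓡∂ (d + 1)) ⊆
      (extChartAt (𝓡∂ (d + 1)) p).target) :
    Dense {g' : minimalConformalClass g | ∀ y ∈ boundaryBall d p r, NondegenerateAt
      (boundaryRep (normSqSecondFundamentalForm (g' : RiemMetric m d M)) p) y} := by
  have hm1 : 1 ≤ m := by omega
  rintro ⟨g₀, hg₀⟩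
  obtain ⟨u, hu, rfl⟩ := (mem_minimalConformalClass_iff g hm1 hd hH g₀).1 hg₀
  choose w hw hwy using exists_coordinate_functions (p := p) hm1 g hr0 hr
  have hΓ : ∀ t, ∀ x ∈ (𝓡∂ (d + 1)).boundary M, normalDeriv g (linearFamily u w t) x = 0 :=
    fun t x hx => normalDeriv_linearFamily hm1 g (hu x hx) (fun j => hw j x hx) t
  let Γ : EuclideanSpace ℝ (Fin d) → minimalConformalClass g := fun t =>
    ⟨conformalMetric g (linearFamily u w t),
      (mem_minimalConformalClass_iff g hm1 hd hH _).2 ⟨_, hΓ t, rfl⟩⟩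
  have hΓc : Continuous Γ := (continuous_conformalMetric_linearFamily g u w).subtype_mk _
  have hΓ0 : Γ 0 = ⟨conformalMetric g u, hg₀⟩ := Subtype.ext (by
    change conformalMetric g (linearFamily u w 0) = _
    rw [linearFamily_zero])
  rw [← hΓ0]
  set V := boundaryDomain d p ∩
    boundaryIncl d ⁻¹' Metric.ball (extChartAt (𝓡∂ (d + 1)) p p) (2 * r)
  have hV : IsOpen V := (isOpen_boundaryDomain p).inter
    (Metric.isOpen_ball.preimage (boundaryIncl d).continuous)
  have hf : ContDiffOn ℝ 2
      (boundaryRep (d := d) (normSqSecondFundamentalForm (conformalMetric g u)) p) V := by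
    refine ContDiffOn.mono ?_ inter_subset_left
    exact_mod_cast contDiffOn_boundaryRep_normSq (n := 2) hm (conformalMetric g u) p
  have hpos : ∀ y ∈ V,
      0 < boundaryRep (d := d) (normSqSecondFundamentalForm (conformalMetric g u)) p y := by
    intro y hy
    rw [boundaryRep_normSq_conformalMetric hm1 u hu hy.1]
    exact mul_pos (Real.exp_pos _) (boundaryRep_normSq_pos hm1 hII hy.1)
  -- Good parameters accumulate at 0, so by continuity good metrics accumulate at `Γ 0`, the given
  -- metric.
  refine map_mem_closure hΓc (dense_nondegenerateAt_mul_exp hV hf hpos 0) fun t ht y hy => ?_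
  have hyV : y ∈ V := by
    refine ⟨boundaryBall_subset ((inter_subset_inter_left _
      (Metric.closedBall_subset_closedBall (by linarith))).trans hr) hy, ?_⟩
    exact Metric.closedBall_subset_ball (by linarith) hy
  refine ht y hyV _ fun z hz => ?_
  change boundaryRep (normSqSecondFundamentalForm (conformalMetric g (linearFamily u w t))) p z = _
  rw [boundaryRep_normSq_conformalMetric hm1 _ (hΓ t) hz.1,
    boundaryRep_normSq_conformalMetric hm1 u hu hz.1, linearFamily_apply, ← mul_assoc,
    ← Real.exp_add]
  have h1 : ∑ j, t j * w j ((extChartAt (𝓡∂ (d + 1)) p).symm (boundaryIncl d z)) =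
      innerSL ℝ t z := by
    rw [innerSL_apply_apply, PiLp.inner_apply]
    refine Finset.sum_congr rfl fun j _ => ?_
    rw [hwy j z hz.1 hz.2]
    simp [mul_comm]
  rw [h1]
  ring_nf

end Density

/-! ### Assembly over a finite cover -/

lemma isOpen_and_dense_biInter {X ι : Type*} [TopologicalSpace X] {U : ι → Set X} (T : Finset ι)
    (hU : ∀ i ∈ T, IsOpen (U i) ∧ Dense (U i)) :
    IsOpen {x | ∀ i ∈ T, x ∈ U i} ∧ Dense {x | ∀ i ∈ T, x ∈ U i} := by
  classical
  induction T using Finset.induction_on with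
  | empty => simp
  | insert a s _ ih =>
    have h1 := hU a (Finset.mem_insert_self a s)
    have h2 := ih fun i hi => hU i (Finset.mem_insert_of_mem hi)
    have h3 : {x | ∀ i ∈ insert a s, x ∈ U i} = U a ∩ {x | ∀ i ∈ s, x ∈ U i} := by
      ext x
      simp
    rw [h3]
    exact ⟨h1.1.inter h2.1, h1.2.inter_of_isOpen_left h2.2 h1.1⟩

lemma isOpen_and_dense_isMorseOnBoundary {m d : ℕ} {M : Type*} [TopologicalSpace M] [T2Space M]
    [CompactSpace M] [ChartedSpace (EuclideanHalfSpace (d + 1)) M]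
    [IsManifold (𝓡∂ (d + 1)) 1 M] [IsManifold (𝓡∂ (d + 1)) ((m + 1 : ℕ) : WithTop ℕ∞) M]
    (hm : 3 ≤ m) (hd : d ≠ 0) {g : RiemMetric m d M} (hH : HasMinimalBoundary g)
    (hII : ∀ p ∈ (𝓡∂ (d + 1)).boundary M, secondFundamentalForm g p ≠ 0) :
    IsOpen {g' : minimalConformalClass g |
      IsMorseOnBoundary d (normSqSecondFundamentalForm (g' : RiemMetric m d M))} ∧
    Dense {g' : minimalConformalClass g |
      IsMorseOnBoundary d (normSqSecondFundamentalForm (g' : RiemMetric m d M))} := by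
  choose R hR0 hR using fun p : M =>
    exists_closedBall_inter_subset_target (mem_extChartAt_target (I := 𝓡∂ (d + 1)) p)
  -- A third of the admissible radius leaves room for the cutoff at three times the covering radius.
  have hr0 : ∀ p, 0 < R p / 3 := fun p => div_pos (hR0 p) three_pos
  have hr3 : ∀ p, Metric.closedBall (extChartAt (𝓡∂ (d + 1)) p p) (3 * (R p / 3)) ∩
      range (𝓡∂ (d + 1)) ⊆ (extChartAt (𝓡∂ (d + 1)) p).target := fun p => by
    rw [mul_div_cancel₀ _ three_ne_zero]
    exact hR p
  have hr : ∀ p, Metric.closedBall (extChartAt (𝓡∂ (d + 1)) p p) (R p / 3) ∩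
      range (𝓡∂ (d + 1)) ⊆ (extChartAt (𝓡∂ (d + 1)) p).target := fun p =>
    (inter_subset_inter_left _
      (Metric.closedBall_subset_closedBall (by linarith [hR0 p]))).trans (hR p)
  obtain ⟨T, hT⟩ := exists_finite_cover d hr0
  have hset : {g' : minimalConformalClass g |
      IsMorseOnBoundary d (normSqSecondFundamentalForm (g' : RiemMetric m d M))} =
      {g' | ∀ p ∈ T, g' ∈ {g' : minimalConformalClass g | ∀ y ∈ boundaryBall d p (R p / 3),
        NondegenerateAt (boundaryRep (normSqSecondFundamentalForm (g' : RiemMetric m d M)) p) y}} :=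
    Set.ext fun g' => isMorseOnBoundary_iff hm (g' : RiemMetric m d M) hr hT
  rw [hset]
  exact isOpen_and_dense_biInter T fun p _ =>
    ⟨isOpen_nondegenerate hm hd hH hII p (isCompact_boundaryBall p _) (boundaryBall_subset (hr p)),
      dense_nondegenerate hm hd hH hII (hr0 p) (hr3 p)⟩

end BoundaryMorse

end

theorem theorem2 {m d : ℕ} (hm : 3 ≤ m) (hd : 2 ≤ d)
    {M : Type*} [TopologicalSpace M] [T2Space M] [CompactSpace M]
    [ChartedSpace (EuclideanHalfSpace (d + 1)) M]
    [IsManifold (𝓡∂ (d + 1)) 1 M] [IsManifold (𝓡∂ (d + 1)) ((m + 1 : ℕ) : WithTop ℕ∞) M]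
    (gbar : RiemMetric m d M)
    (hH : HasMinimalBoundary gbar)
    (hII : ∀ p ∈ (𝓡∂ (d + 1)).boundary M, secondFundamentalForm gbar p ≠ 0) :
    -- the metrics of the conformal class with minimal boundary, and the norm of their second
    -- fundamental form
    (∀ g : RiemMetric m d M, g ∈ minimalConformalClass gbar ↔
      ∃ u : C^m⟮𝓡∂ (d + 1), M; 𝓘(ℝ, ℝ), ℝ⟯,
        (∀ p ∈ (𝓡∂ (d + 1)).boundary M, normalDeriv gbar u p = 0) ∧
        g = conformalMetric gbar u) ∧
    (∀ u : C^m⟮𝓡∂ (d + 1), M; 𝓘(ℝ, ℝ), ℝ⟯,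
      (∀ p ∈ (𝓡∂ (d + 1)).boundary M, normalDeriv gbar u p = 0) →
      ∀ p ∈ (𝓡∂ (d + 1)).boundary M,
        normSqSecondFundamentalForm (conformalMetric gbar u) p =
          Real.exp (-2 * u p) * normSqSecondFundamentalForm gbar p) ∧
    -- the Morse condition is open and dense among them
    IsOpen {g : minimalConformalClass gbar |
      IsMorseOnBoundary d (normSqSecondFundamentalForm (g : RiemMetric m d M))} ∧
    Dense {g : minimalConformalClass gbar |
      IsMorseOnBoundary d (normSqSecondFundamentalForm (g : RiemMetric m d M))} := by
  have hm1 : 1 ≤ m := by omega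
  have hd0 : d ≠ 0 := by omega
  exact ⟨mem_minimalConformalClass_iff gbar hm1 hd0 hH,
    fun u hu p hp => normSq_conformalMetric gbar u p hm1 (hu p hp),
    isOpen_and_dense_isMorseOnBoundary hm hd0 hH hII⟩
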